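/- A weighted graph $G=(X,b,m)$ consists of a countable vertex set $X$, a symmetric edge weight $b:X\times X\to[0,\infty)$ with $b(x,x)=0$ and $\{y: b(x,y)>0\}$ finite for every $x$, and a vertex measure $m:X\to(0,\infty)$; write $x\sim y$ if $b(x,y)>0$. All graphs are assumed connected. Let $\mathcal L f(x)=\frac1{m(x)}\sum_y b(x,y)(f(x)-f(y))$, let $L$ be the Friedrichs (that is, the smallest self-adjoint) extension of $\mathcal L$ restricted to the finitely supported functions in $\ell^2(X,m)$, and let $p_t(x,y)$, $t>0$, be the heat kernel, determined by $e^{-tL}f(x)=\sum_y p_t(x,y)f(y)m(y)$ for $f\in\ell^2(X,m)$. Let $g(x,y)=\int_0^\infty p_t(x,y)\,dt\in[0,\infty]$ be the Green's function. The graph $G$ * is stochastically incomplete (SI) if $\sum_{y} p_t(x,y)m(y)<1$ for some (all) $x\in X$ and some (all) $t>0$; * has the Feller property (FP) if $p_t(x,y)\to0$ as $y\to\infty$ (that is, as $y$ leaves every finite set) for some (all) $x\in X$ and some (all) $t>0$; * is uniformly transient (UT) if there is a constant $C>0$ with $g(x,x)\le C$ for all $x\in X$. A regular covering of $G=(X,b,m)$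 by a weighted graph $\tilde G=(\tilde X,\tilde b,\tilde m)$ is an onto map $\pi:\tilde X\to X$ which maps the neighborhood $\{\tilde y:\tilde y\sim\tilde x\}$ of every $\tilde x\in\tilde X$ bijectively onto the neighborhood of $\pi(\tilde x)$, which satisfies $\tilde b(\tilde x,\tilde y)=b(\pi(\tilde x),\pi(\tilde y))$ whenever $\tilde x\sim\tilde y$ and $\tilde m(\tilde x)=m(\pi(\tilde x))$ for all $\tilde x$, and for which the group of deck transformations (the automorphisms $\gamma$ of the weighted graph $\tilde G$ with $\pi\circ\gamma=\pi$) acts transitively on each fiber $\pi^{-1}(x)$. The number of sheets is the cardinality of a fiber. **Theorem.** Let $\pi:\tilde G\to G$ be a regular covering of weighted graphs. 1. $\tilde G$ satisfies (SI) if and only if $G$ satisfies (SI). 2. If $G$ satisfies (FP), then $\tilde G$ satisfies (FP). 3. If $G$ satisfies (UT), then $\tilde G$ satisfies (UT). Furthermore, if the covering has finitely many sheets, then $G$ satisfies (FP) if and only if $\tilde G$ satisfies (FP), and $G$ satisfies (UT) if and only if $\tilde G$ satisfies (UT). In (SI) and (FP) one may read "for some" throughout or "for all" throughout, for $x$ and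 $t$ and for both graphs; the theorem is asserted for each of these two readings. -/

import Mathlib

open MeasureTheory Filter Topology
open scoped ENNReal InnerProductSpace LinearPMap

noncomputable section

namespace LinearPMap

section Friedrichs

variable {H : Type*} [NormedAddCommGroup H] [InnerProductSpace ℂ H]

/-- A densely defined, symmetric, nonnegative operator on a complex Hilbert space. -/
structure IsNonnegSymmetric (S : H →ₗ.[ℂ] H) : Prop where
  dense : Dense (S.domain : Set H)
  symm : ∀ φ ψ : S.domain, ⟪S φ, (ψ : H)⟫_ℂ = ⟪(φ : H), S ψ⟫_ℂ
  nonneg : ∀ φ : S.domain, 0 ≤ (⟪S φ, (φ : H)⟫_ℂ).re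

/-- The quadratic form `φ ↦ ⟨S φ, φ⟩` on the domain of `S`. -/
def form (S : H →ₗ.[ℂ] H) (φ : S.domain) : ℝ := (⟪S φ, (φ : H)⟫_ℂ).re

theorem form_add_add_form_sub (S : H →ₗ.[ℂ] H) (a b : S.domain) :
    S.form (a + b) + S.form (a - b) = 2 * S.form a + 2 * S.form b := by
  simp only [form, LinearPMap.map_add, LinearPMap.map_sub, Submodule.coe_add, Submodule.coe_sub,
    inner_add_left, inner_add_right, inner_sub_left, inner_sub_right, Complex.add_re,
    Complex.sub_re]
  ring

theorem form_smul (S : H →ₗ.[ℂ] H) (c : ℂ) (a : S.domain) :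
    S.form (c • a) = ‖c‖ ^ 2 * S.form a := by
  have h : ⟪S (c • a), ((c • a : S.domain) : H)⟫_ℂ = ((‖c‖ ^ 2 : ℝ) : ℂ) * ⟪S a, (a : H)⟫_ℂ := by
    rw [LinearPMap.map_smul, Submodule.coe_smul, inner_smul_left, inner_smul_right, ← mul_assoc,
      Complex.conj_mul']
    push_cast
    rfl
  simp only [form, h, Complex.re_ofReal_mul]

/-- The closure of the domain of `S` with respect to the form norm
`φ ↦ (‖φ‖² + ⟨S φ, φ⟩)^(1/2)`, realized inside the Hilbert space: the limits in `H` of the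
sequences in the domain of `S` that converge in `H` and are Cauchy for the form of `S`. -/
def formDomain (S : H →ₗ.[ℂ] H) (hS : S.IsNonnegSymmetric) : Submodule ℂ H where
  carrier := {u | ∃ φ : ℕ → S.domain, Tendsto (fun n => (φ n : H)) atTop (𝓝 u) ∧
    ∀ ε > 0, ∃ N, ∀ k ≥ N, ∀ n ≥ N, S.form (φ k - φ n) < ε}
  zero_mem' := ⟨fun _ => 0, by simp, fun ε hε => ⟨0, fun k _ n _ => by simpa [form] using hε⟩⟩
  add_mem' := by
    rintro u v ⟨φ, hφ, hφ'⟩ ⟨ψ, hψ, hψ'⟩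
    refine ⟨fun n => φ n + ψ n, by simpa using hφ.add hψ, fun ε hε => ?_⟩
    obtain ⟨N, hN⟩ := hφ' (ε / 4) (by positivity)
    obtain ⟨M, hM⟩ := hψ' (ε / 4) (by positivity)
    refine ⟨max N M, fun k hk n hn => ?_⟩
    have h1 := hN k (le_trans (le_max_left _ _) hk) n (le_trans (le_max_left _ _) hn)
    have h2 := hM k (le_trans (le_max_right _ _) hk) n (le_trans (le_max_right _ _) hn)
    have h3 := S.form_add_add_form_sub (φ k - φ n) (ψ k - ψ n)
    have h4 : 0 ≤ S.form ((φ k - φ n) - (ψ k - ψ n)) := hS.nonneg _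
    have h5 : φ k + ψ k - (φ n + ψ n) = (φ k - φ n) + (ψ k - ψ n) := by abel
    rw [h5]
    linarith
  smul_mem' := by
    rintro c u ⟨φ, hφ, hφ'⟩
    refine ⟨fun n => c • φ n, by simpa using hφ.const_smul c, fun ε hε => ?_⟩
    obtain ⟨N, hN⟩ := hφ' (ε / (‖c‖ ^ 2 + 1)) (by positivity)
    refine ⟨N, fun k hk n hn => ?_⟩
    have h1 := hN k hk n hn
    have h2 : 0 ≤ S.form (φ k - φ n) := hS.nonneg _
    rw [← smul_sub, form_smul]
    rw [lt_div_iff₀ (by positivity)] at h1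
    nlinarith

/-- The Friedrichs extension is nonnegative. -/
theorem friedrichs_nonneg (S : H →ₗ.[ℂ] H) (hS : S.IsNonnegSymmetric) {u g : H}
    (hu : u ∈ S.formDomain hS) (h : ∀ φ : S.domain, ⟪g, (φ : H)⟫_ℂ = ⟪u, S φ⟫_ℂ) :
    0 ≤ (⟪g, u⟫_ℂ).re := by
  obtain ⟨φ, hφ, hφ'⟩ := hu
  have hlim : Tendsto (fun n => (⟪g, (φ n : H)⟫_ℂ).re) atTop (𝓝 (⟪g, u⟫_ℂ).re) :=
    (Complex.continuous_re.tendsto _).comp (tendsto_const_nhds.inner hφ)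
  refine le_of_forall_pos_le_add fun ε hε => ?_
  obtain ⟨N, hN⟩ := hφ' ε hε
  have key : ∀ n ≥ N, -ε ≤ (⟪g, (φ n : H)⟫_ℂ).re := by
    intro n hn
    rw [h]
    have hlim2 : Tendsto (fun k => (⟪(φ k : H), S (φ n)⟫_ℂ).re) atTop
        (𝓝 (⟪u, S (φ n)⟫_ℂ).re) :=
      (Complex.continuous_re.tendsto _).comp (hφ.inner tendsto_const_nhds)
    refine ge_of_tendsto hlim2 (eventually_atTop.2 ⟨N, fun k hk => ?_⟩)
    have h1 := hN k hk n hn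
    have h2 : S.form (φ k - φ n) = S.form (φ k) + S.form (φ n)
        - 2 * (⟪(φ k : H), S (φ n)⟫_ℂ).re := by
      have e1 : (⟪S (φ n), (φ k : H)⟫_ℂ).re = (⟪(φ k : H), S (φ n)⟫_ℂ).re :=
        inner_re_symm (𝕜 := ℂ) _ _
      simp only [form, LinearPMap.map_sub, Submodule.coe_sub, inner_sub_left, inner_sub_right,
        Complex.sub_re, hS.symm (φ k) (φ n), e1]
      ring
    have h3 : 0 ≤ S.form (φ k) := hS.nonneg _
    have h4 : 0 ≤ S.form (φ n) := hS.nonneg _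
    linarith
  have := ge_of_tendsto hlim (eventually_atTop.2 ⟨N, key⟩)
  linarith

variable [CompleteSpace H]

/-- The Friedrichs extension of `S`: the restriction of the adjoint `S†` to the form domain. -/
def friedrichs (S : H →ₗ.[ℂ] H) (hS : S.IsNonnegSymmetric) : H →ₗ.[ℂ] H :=
  S†.domRestrict (S.formDomain hS)

theorem mem_friedrichs_iff (S : H →ₗ.[ℂ] H) (hS : S.IsNonnegSymmetric) (u g : H) :
    (∃ hu : u ∈ (S.friedrichs hS).domain, S.friedrichs hS ⟨u, hu⟩ = g) ↔
      u ∈ S.formDomain hS ∧ ∀ φ : S.domain, ⟪g, (φ : H)⟫_ℂ = ⟪u, S φ⟫_ℂ := by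
  constructor
  · rintro ⟨hu, rfl⟩
    refine ⟨hu.1, fun φ => ?_⟩
    have h : S.friedrichs hS ⟨u, hu⟩ = S† ⟨u, hu.2⟩ := LinearPMap.domRestrict_apply rfl
    rw [h]
    exact LinearPMap.adjoint_isFormalAdjoint hS.dense ⟨u, hu.2⟩ φ
  · rintro ⟨hu, h⟩
    have hu' : u ∈ S†.domain := LinearPMap.mem_adjoint_domain_of_exists u ⟨g, h⟩
    refine ⟨⟨hu, hu'⟩, ?_⟩
    have h1 : S.friedrichs hS ⟨u, ⟨hu, hu'⟩⟩ = S† ⟨u, hu'⟩ := LinearPMap.domRestrict_apply rfl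
    rw [h1]
    exact LinearPMap.adjoint_apply_eq hS.dense ⟨u, hu'⟩ h

/-- Solvability of `(A + 1) u = f` for the Friedrichs extension `A`. -/
theorem exists_friedrichs_solution (S : H →ₗ.[ℂ] H) (hS : S.IsNonnegSymmetric) (f : H) :
    ∃ u ∈ S.formDomain hS, ∀ φ : S.domain, ⟪f - u, (φ : H)⟫_ℂ = ⟪u, S φ⟫_ℂ := by
  let E : S.domain → ℝ := fun φ => S.form φ + ‖(φ : H)‖ ^ 2 - 2 * (⟪(φ : H), f⟫_ℂ).re
  have hbd : ∀ φ, -‖f‖ ^ 2 ≤ E φ := by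
    intro φ
    have h1 : 0 ≤ S.form φ := hS.nonneg φ
    have h2 : (⟪(φ : H), f⟫_ℂ).re ≤ ‖(φ : H)‖ * ‖f‖ := re_inner_le_norm (𝕜 := ℂ) _ _
    have h3 := sq_nonneg (‖(φ : H)‖ - ‖f‖)
    simp only [E]
    nlinarith
  have hbdd : BddBelow (Set.range E) := ⟨_, by rintro _ ⟨φ, rfl⟩; exact hbd φ⟩
  set d := ⨅ φ, E φ with hd
  have hle : ∀ φ, d ≤ E φ := fun φ => ciInf_le hbdd φ
  have hex : ∀ n : ℕ, ∃ φ, E φ < d + 1 / ((n : ℝ) + 1) := fun n =>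
    exists_lt_of_ciInf_lt (by have : 0 < 1 / ((n : ℝ) + 1) := by positivity
                              linarith)
  choose φ hφ using hex
  have hpar : ∀ a b : S.domain, S.form (a - b) + ‖(a : H) - b‖ ^ 2 ≤ 2 * E a + 2 * E b - 4 * d := by
    intro a b
    have h1 := S.form_add_add_form_sub a b
    have h2 := parallelogram_law_with_norm ℂ (a : H) (b : H)
    have h3 := hle ((1 / 2 : ℂ) • (a + b))
    simp only [E] at h3 ⊢
    rw [form_smul, Submodule.coe_smul, norm_smul, Submodule.coe_add, inner_smul_left,
      inner_add_left] at h3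
    have h4 : ‖(1 / 2 : ℂ)‖ = 1 / 2 := by norm_num
    have h5 : ((starRingEnd ℂ) (1 / 2) * (⟪(a : H), f⟫_ℂ + ⟪(b : H), f⟫_ℂ)).re
        = (1 / 2) * ((⟪(a : H), f⟫_ℂ).re + (⟪(b : H), f⟫_ℂ).re) := by
      have : (starRingEnd ℂ) (1 / 2) = ((1 / 2 : ℝ) : ℂ) := by
        rw [show (1 / 2 : ℂ) = ((1 / 2 : ℝ) : ℂ) by push_cast; rfl, Complex.conj_ofReal]
      rw [this, Complex.re_ofReal_mul, Complex.add_re]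
    rw [h4, h5] at h3
    nlinarith
  have hsmall : ∀ ε > 0, ∃ N, ∀ k ≥ N, ∀ n ≥ N,
      S.form (φ k - φ n) + ‖(φ k : H) - φ n‖ ^ 2 < ε := by
    intro ε hε
    obtain ⟨N, hN⟩ := exists_nat_one_div_lt (show 0 < ε / 4 by positivity)
    have hmono : ∀ k ≥ N, E (φ k) < d + ε / 4 := by
      intro k hk
      have h1 : 1 / ((k : ℝ) + 1) ≤ 1 / ((N : ℝ) + 1) := Nat.one_div_le_one_div hk
      linarith [hφ k]
    exact ⟨N, fun k hk n hn => by linarith [hpar (φ k) (φ n), hmono k hk, hmono n hn]⟩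
  have hcauchy : CauchySeq fun n => (φ n : H) := by
    rw [Metric.cauchySeq_iff]
    intro ε hε
    obtain ⟨N, hN⟩ := hsmall (ε ^ 2) (by positivity)
    refine ⟨N, fun k hk n hn => ?_⟩
    rw [dist_eq_norm]
    have h1 : 0 ≤ S.form (φ k - φ n) := hS.nonneg _
    exact lt_of_pow_lt_pow_left₀ 2 hε.le (by linarith [hN k hk n hn])
  obtain ⟨u, hu⟩ := cauchySeq_tendsto_of_complete hcauchy
  refine ⟨u, ⟨φ, hu, fun ε hε => ?_⟩, ?_⟩
  · obtain ⟨N, hN⟩ := hsmall ε hε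
    exact ⟨N, fun k hk n hn => by linarith [hN k hk n hn, sq_nonneg ‖(φ k : H) - φ n‖]⟩
  have hEL : ∀ ψ : S.domain, (⟪u, S ψ⟫_ℂ).re + (⟪u, (ψ : H)⟫_ℂ).re - (⟪f, (ψ : H)⟫_ℂ).re = 0 := by
    intro ψ
    set c : ℕ → ℝ := fun n => (⟪(φ n : H), S ψ⟫_ℂ).re + (⟪(φ n : H), (ψ : H)⟫_ℂ).re
      - (⟪f, (ψ : H)⟫_ℂ).re with hc
    set C := (⟪u, S ψ⟫_ℂ).re + (⟪u, (ψ : H)⟫_ℂ).re - (⟪f, (ψ : H)⟫_ℂ).re with hC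
    set A := S.form ψ + ‖(ψ : H)‖ ^ 2 with hA
    have hclim : Tendsto c atTop (𝓝 C) :=
      (((Complex.continuous_re.tendsto _).comp (hu.inner tendsto_const_nhds)).add
        ((Complex.continuous_re.tendsto _).comp (hu.inner tendsto_const_nhds))).sub
          tendsto_const_nhds
    have hexp : ∀ (n : ℕ) (s : ℝ), E (φ n + (s : ℂ) • ψ) = E (φ n) + 2 * s * c n + s ^ 2 * A := by
      intro n s
      have e1 : (⟪S ψ, (φ n : H)⟫_ℂ).re = (⟪(φ n : H), S ψ⟫_ℂ).re := inner_re_symm (𝕜 := ℂ) _ _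
      have e2 : (⟪(ψ : H), f⟫_ℂ).re = (⟪f, (ψ : H)⟫_ℂ).re := inner_re_symm (𝕜 := ℂ) _ _
      have e3 : ‖(φ n : H) + (s : ℂ) • (ψ : H)‖ ^ 2
          = ‖(φ n : H)‖ ^ 2 + 2 * s * (⟪(φ n : H), (ψ : H)⟫_ℂ).re + s ^ 2 * ‖(ψ : H)‖ ^ 2 := by
        rw [norm_add_sq (𝕜 := ℂ), inner_smul_right, norm_smul]
        simp only [RCLike.re_to_complex, Complex.re_ofReal_mul, Complex.norm_real, mul_pow,
          Real.norm_eq_abs, sq_abs]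
        ring
      have e4 : S.form (φ n + (s : ℂ) • ψ)
          = S.form (φ n) + 2 * s * (⟪(φ n : H), S ψ⟫_ℂ).re + s ^ 2 * S.form ψ := by
        simp only [form, LinearPMap.map_add, LinearPMap.map_smul, Submodule.coe_add,
          Submodule.coe_smul, inner_add_left, inner_add_right, inner_smul_left, inner_smul_right,
          Complex.conj_ofReal, Complex.add_re, Complex.re_ofReal_mul, hS.symm (φ n) ψ, e1]
        ring
      simp only [E, e4, Submodule.coe_add, Submodule.coe_smul, e3, inner_add_left, inner_smul_left,
          Complex.conj_ofReal, Complex.add_re, Complex.re_ofReal_mul, e2, hc, hA]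
      ring
    have hineq : ∀ s : ℝ, 0 ≤ 2 * s * C + s ^ 2 * A := by
      intro s
      have hl : Tendsto (fun n : ℕ => 2 * s * c n + s ^ 2 * A + 1 / ((n : ℝ) + 1)) atTop
          (𝓝 (2 * s * C + s ^ 2 * A + 0)) :=
        ((hclim.const_mul (2 * s)).add tendsto_const_nhds).add
          tendsto_one_div_add_atTop_nhds_zero_nat
      rw [add_zero] at hl
      refine ge_of_tendsto' hl fun n => ?_
      have h1 := hle (φ n + (s : ℂ) • ψ)
      rw [hexp] at h1
      linarith [hφ n]
    have hA0 : 0 ≤ A := add_nonneg (hS.nonneg ψ) (sq_nonneg _)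
    have h1 := hineq (-C / (A + 1))
    have h2 : 2 * (-C / (A + 1)) * C + (-C / (A + 1)) ^ 2 * A
        = -(C ^ 2 * (A + 2)) / (A + 1) ^ 2 := by
      field_simp
      ring
    rw [h2, le_div_iff₀ (by positivity)] at h1
    have h3 : C ^ 2 ≤ 0 := by nlinarith [sq_nonneg C]
    exact pow_eq_zero_iff (two_ne_zero) |>.1 (le_antisymm h3 (sq_nonneg C))
  intro ψ
  rw [inner_sub_left]
  apply Complex.ext
  · have := hEL ψ
    simp only [Complex.sub_re]
    linarith
  · have := hEL (Complex.I • ψ)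
    simp only [LinearPMap.map_smul, Submodule.coe_smul, inner_smul_right, Complex.I_mul_re] at this
    simp only [Complex.sub_im]
    linarith

/-- For the Friedrichs extension `A` of `S`, the operator `A + 1` has an everywhere defined bounded
inverse. -/
theorem exists_friedrichs_resolvent (S : H →ₗ.[ℂ] H) (hS : S.IsNonnegSymmetric) :
    ∃ R : H →L[ℂ] H, ∀ f u : H, R f = u ↔
      ∃ hu : u ∈ (S.friedrichs hS).domain, S.friedrichs hS ⟨u, hu⟩ + u = f := by
  have hiff : ∀ f u : H, (∃ hu : u ∈ (S.friedrichs hS).domain, S.friedrichs hS ⟨u, hu⟩ + u = f) ↔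
      u ∈ S.formDomain hS ∧ ∀ φ : S.domain, ⟪f - u, (φ : H)⟫_ℂ = ⟪u, S φ⟫_ℂ := by
    intro f u
    rw [← mem_friedrichs_iff]
    simp only [eq_sub_iff_add_eq]
  have hbound : ∀ f u : H, (u ∈ S.formDomain hS ∧
      ∀ φ : S.domain, ⟪f - u, (φ : H)⟫_ℂ = ⟪u, S φ⟫_ℂ) → ‖u‖ ≤ ‖f‖ := by
    rintro f u ⟨hu, h⟩
    have h1 := S.friedrichs_nonneg hS hu h
    rw [inner_sub_left, Complex.sub_re] at h1
    have h2 : (⟪u, u⟫_ℂ).re = ‖u‖ ^ 2 := inner_self_eq_norm_sq (𝕜 := ℂ) u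
    have h3 : (⟪f, u⟫_ℂ).re ≤ ‖f‖ * ‖u‖ := re_inner_le_norm (𝕜 := ℂ) _ _
    by_contra hlt
    push Not at hlt
    nlinarith [norm_nonneg f, norm_nonneg u]
  choose r hr using S.exists_friedrichs_solution hS
  have huniq : ∀ f u : H, (u ∈ S.formDomain hS ∧
      ∀ φ : S.domain, ⟪f - u, (φ : H)⟫_ℂ = ⟪u, S φ⟫_ℂ) → r f = u := by
    rintro f u ⟨hu, h⟩
    have := hbound 0 (r f - u) ⟨Submodule.sub_mem _ (hr f).1 hu, fun φ => by
      rw [inner_sub_left, inner_sub_left, inner_sub_left, ← (hr f).2 φ, ← h φ, inner_sub_left,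
        inner_sub_left, inner_zero_left]
      ring⟩
    rw [norm_zero, norm_le_zero_iff, sub_eq_zero] at this
    exact this
  refine ⟨LinearMap.mkContinuous
    { toFun := r
      map_add' := fun f g => huniq _ _ ⟨Submodule.add_mem _ (hr f).1 (hr g).1, fun φ => by
        rw [inner_add_left, ← (hr f).2 φ, ← (hr g).2 φ, ← inner_add_left]
        congr 1
        abel⟩
      map_smul' := fun c f => huniq _ _ ⟨Submodule.smul_mem _ c (hr f).1, fun φ => by
        rw [RingHom.id_apply, inner_smul_left, ← (hr f).2 φ, ← inner_smul_left, smul_sub]⟩ } 1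
    fun f => by simpa using hbound f (r f) (hr f), fun f u => ?_⟩
  rw [hiff]
  constructor
  · rintro rfl
    exact hr f
  · exact huniq f u

end Friedrichs

end LinearPMap

/-- A weighted graph `(X, b, m)`: a symmetric edge weight `b ≥ 0` vanishing on the diagonal, locally
finite and connected, together with a vertex measure `m > 0`. -/
structure WeightedGraph (X : Type*) where
  b : X → X → ℝ
  m : X → ℝ
  b_nonneg : ∀ x y, 0 ≤ b x y
  b_self : ∀ x, b x x = 0
  b_symm : ∀ x y, b x y = b y x
  locallyFinite : ∀ x, {y | 0 < b x y}.Finite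
  m_pos : ∀ x, 0 < m x
  connected : ∀ x y, Relation.ReflTransGen (fun u v => 0 < b u v) x y

namespace WeightedGraph

variable {X : Type*} (G : WeightedGraph X)

/-- The neighborhood `{y | y ∼ x}` of a vertex, as a finite set. -/
def nbhd (x : X) : Finset X := (G.locallyFinite x).toFinset

/-- The formal Laplacian `𝓛 f (x) = (1 / m x) ∑_y b x y (f x - f y)`. -/
def formalLaplacian (f : X → ℂ) (x : X) : ℂ :=
  (1 / (G.m x : ℂ)) * ∑ y ∈ G.nbhd x, (G.b x y : ℂ) * (f x - f y)

/-- The vertex measure, extended to all subsets of `X` by countable additivity. -/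
def measure : @Measure X ⊤ :=
  @Measure.sum X X ⊤ fun x => ENNReal.ofReal (G.m x) • @Measure.dirac X ⊤ x

/-- The (complexified) Hilbert space `ℓ²(X, m)`. -/
def ell2 : Type _ := @Lp X ℂ ⊤ _ 2 G.measure

instance : NormedAddCommGroup G.ell2 := inferInstanceAs (NormedAddCommGroup (Lp ℂ 2 G.measure))

instance : InnerProductSpace ℂ G.ell2 := inferInstanceAs (InnerProductSpace ℂ (Lp ℂ 2 G.measure))

instance : CompleteSpace G.ell2 := inferInstanceAs (CompleteSpace (Lp ℂ 2 G.measure))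

variable {G} in
/-- An element of `ℓ²(X, m)` as a function on `X`. All values are determined, because every vertex
has positive measure. -/
def ell2.eval (f : G.ell2) : X → ℂ :=
  @AEEqFun.cast X ℂ ⊤ G.measure _ (Subtype.val (p := (· ∈ Lp ℂ 2 G.measure)) f)

instance : CoeFun G.ell2 fun _ => X → ℂ := ⟨ell2.eval⟩

theorem measure_singleton (x : X) : G.measure {x} = ENNReal.ofReal (G.m x) := by
  let _ : MeasurableSpace X := ⊤
  rw [measure, Measure.sum_apply _ MeasurableSpace.measurableSet_top, tsum_eq_single x]
  · simp
  · intro y hy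
    simp [hy]

theorem ae_iff_forall {p : X → Prop} :
    (∀ᵐ x ∂G.measure, p x) ↔ ∀ x, p x := by
  refine ⟨fun h x => ?_, fun h => Eventually.of_forall h⟩
  by_contra hx
  have h1 : G.measure {x} ≤ 0 := by
    rw [← (mem_ae_iff.1 h : G.measure {x | p x}ᶜ = 0)]
    exact measure_mono (by simpa using hx)
  rw [measure_singleton] at h1
  exact absurd (ENNReal.ofReal_pos.2 (G.m_pos x)) (not_lt.2 h1)

theorem ell2_ext {f g : G.ell2} (h : ∀ x, f x = g x) : f = g :=
  Lp.ext (Eventually.of_forall h)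

theorem ell2_add_apply (f g : G.ell2) (x : X) : (f + g) x = f x + g x :=
  G.ae_iff_forall.1 (Lp.coeFn_add f g) x

theorem ell2_smul_apply (c : ℂ) (f : G.ell2) (x : X) : (c • f) x = c * f x :=
  G.ae_iff_forall.1 (Lp.coeFn_smul c f) x

theorem ell2_zero_apply (x : X) : (0 : G.ell2) x = 0 :=
  G.ae_iff_forall.1 (Lp.coeFn_zero ℂ 2 G.measure) x

theorem memLp_of_finite_support {f : X → ℂ} (hf : (Function.support f).Finite) :
    MemLp f 2 G.measure := by
  classical
  let _ : MeasurableSpace X := ⊤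
  have h : f = ∑ x ∈ hf.toFinset, Set.indicator {x} (fun _ => f x) := by
    ext y
    simp only [Finset.sum_apply, Set.indicator_apply, Set.mem_singleton_iff]
    rw [Finset.sum_ite_eq]
    by_cases hy : f y = 0 <;> simp [hy]
  rw [h]
  exact memLp_finsetSum' _ fun x _ => memLp_indicator_const 2
    MeasurableSpace.measurableSet_top _
    (Or.inr (by rw [measure_singleton]; exact ENNReal.ofReal_ne_top))

/-- The element of `ℓ²(X, m)` given by a finitely supported function. -/
def ofFinite (f : X → ℂ) (hf : (Function.support f).Finite) : G.ell2 :=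
  (G.memLp_of_finite_support hf).toLp f

theorem ofFinite_apply (f : X → ℂ) (hf : (Function.support f).Finite) (x : X) :
    G.ofFinite f hf x = f x :=
  G.ae_iff_forall.1 (MemLp.coeFn_toLp _) x

theorem finite_support_single (x : X) (c : ℂ) :
    (Function.support (Set.indicator {x} fun _ => c)).Finite :=
  (Set.finite_singleton x).subset Set.support_indicator_subset

/-- The indicator function `1_x` as an element of `ℓ²(X, m)`. -/
def single (x : X) : G.ell2 :=
  G.ofFinite (Set.indicator {x} fun _ => 1) (finite_support_single x 1)

/-- `C_c(X)`, the finitely supported functions, inside `ℓ²(X, m)`. -/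
def finitelySupported : Submodule ℂ G.ell2 where
  carrier := {f | (Function.support (f : X → ℂ)).Finite}
  zero_mem' := by
    refine Set.finite_empty.subset fun x hx => ?_
    exact absurd (G.ell2_zero_apply x) hx
  add_mem' := by
    intro f g hf hg
    refine (Set.Finite.union hf hg).subset fun x hx => ?_
    by_contra h
    simp only [Set.mem_union, Function.mem_support, not_or, not_not] at h
    exact hx (by rw [ell2_add_apply, h.1, h.2, add_zero])
  smul_mem' := by
    intro c f hf
    refine Set.Finite.subset hf fun x hx => ?_
    contrapose! hx
    simp only [Function.mem_support, not_not] at hx ⊢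
    rw [ell2_smul_apply, hx, mul_zero]

theorem support_formalLaplacian_finite {f : X → ℂ} (hf : (Function.support f).Finite) :
    (Function.support (G.formalLaplacian f)).Finite := by
  classical
  refine (hf.union (hf.biUnion fun x _ => (G.nbhd x).finite_toSet)).subset fun x hx => ?_
  by_contra h
  simp only [Set.mem_union, Set.mem_iUnion, Function.mem_support, not_or, not_exists,
    not_not] at h
  refine hx ?_
  rw [formalLaplacian, Finset.sum_eq_zero, mul_zero]
  intro y hy
  have hxy : x ∈ G.nbhd y := by
    simp only [nbhd, Set.Finite.mem_toFinset, Set.mem_ofPred_eq] at hy ⊢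
    rwa [G.b_symm]
  have : f y = 0 := by
    by_contra hfy
    exact h.2 y hfy hxy
  rw [h.1, this]
  simp

/-- The restriction of the formal Laplacian to `C_c(X)`, an unbounded operator on `ℓ²(X, m)`. -/
def minimalLaplacian : G.ell2 →ₗ.[ℂ] G.ell2 where
  domain := G.finitelySupported
  toFun :=
    { toFun := fun f => G.ofFinite (G.formalLaplacian f.1) (G.support_formalLaplacian_finite f.2)
      map_add' := by
        intro f g
        refine G.ell2_ext fun x => ?_
        simp only [ell2_add_apply, ofFinite_apply, formalLaplacian, Submodule.coe_add, ← mul_add,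
          ← Finset.sum_add_distrib]
        congr 1
        exact Finset.sum_congr rfl fun y _ => by ring
      map_smul' := by
        intro c f
        refine G.ell2_ext fun x => ?_
        simp only [ell2_smul_apply, ofFinite_apply, formalLaplacian, Submodule.coe_smul,
          RingHom.id_apply, Finset.mul_sum]
        exact Finset.sum_congr rfl fun y _ => by ring }

theorem minimalLaplacian_apply (f : G.minimalLaplacian.domain) (x : X) :
    G.minimalLaplacian f x = G.formalLaplacian f.1 x :=
  G.ofFinite_apply _ (G.support_formalLaplacian_finite f.2) x

theorem inner_eq_sum (f g : G.ell2) (s : Finset X) (hs : ∀ x, g x ≠ 0 → x ∈ s) :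
    ⟪f, g⟫_ℂ = ∑ x ∈ s, (G.m x : ℂ) * (starRingEnd ℂ (f x) * g x) := by
  let _ : MeasurableSpace X := ⊤
  have hfin : ∀ x ∈ s, G.measure {x} < ⊤ := fun x _ => by
    rw [measure_singleton]
    exact ENNReal.ofReal_lt_top
  have hdef : ⟪f, g⟫_ℂ = ∫ x, ⟪f x, g x⟫_ℂ ∂G.measure :=
    L2.inner_def (𝕜 := ℂ) (μ := G.measure) (f : Lp ℂ 2 G.measure) g
  have hint : Integrable (fun x => ⟪f x, g x⟫_ℂ) G.measure :=
    L2.integrable_inner (𝕜 := ℂ) (μ := G.measure) (f : Lp ℂ 2 G.measure) g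
  rw [hdef, ← setIntegral_eq_integral_of_forall_compl_eq_zero (s := (s : Set X)),
    setIntegral_finset]
  · refine Finset.sum_congr rfl fun x _ => ?_
    rw [measureReal_def, measure_singleton, ENNReal.toReal_ofReal (G.m_pos x).le, RCLike.inner_apply,
      Complex.real_smul]
    ring
  · exact hint.integrableOn
  · intro x hx
    have : g x = 0 := by
      by_contra h
      exact hx (hs x h)
    simp [this]

theorem inner_minimalLaplacian (f g : G.minimalLaplacian.domain) (s : Finset X)
    (hs : ∀ x, g.1 x ≠ 0 → x ∈ s) (hs' : ∀ x, g.1 x ≠ 0 → G.nbhd x ⊆ s) :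
    ⟪G.minimalLaplacian f, (g : G.ell2)⟫_ℂ = (1 / 2) * ∑ x ∈ s, ∑ y ∈ s,
      (G.b x y : ℂ) * (starRingEnd ℂ (f.1 x - f.1 y) * (g.1 x - g.1 y)) := by
  have h1 : ⟪G.minimalLaplacian f, (g : G.ell2)⟫_ℂ = ∑ x ∈ s, ∑ y ∈ s,
      (G.b x y : ℂ) * (starRingEnd ℂ (f.1 x - f.1 y) * g.1 x) := by
    rw [G.inner_eq_sum _ _ s hs]
    refine Finset.sum_congr rfl fun x _ => ?_
    by_cases hg : g.1 x = 0
    · simp [hg]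
    rw [minimalLaplacian_apply, formalLaplacian, Finset.sum_subset (hs' x hg)]
    · have hm : (G.m x : ℂ) ≠ 0 := by exact_mod_cast (G.m_pos x).ne'
      simp only [map_mul, map_sum, map_div₀, map_one, Complex.conj_ofReal, Finset.mul_sum,
        Finset.sum_mul]
      refine Finset.sum_congr rfl fun y _ => ?_
      field_simp
    · intro y _ hy
      have h0 : G.b x y = 0 := by
        simp only [nbhd, Set.Finite.mem_toFinset, Set.mem_ofPred_eq, not_lt] at hy
        exact le_antisymm hy (G.b_nonneg x y)
      simp [h0]
  have h2 : ∑ x ∈ s, ∑ y ∈ s, (G.b x y : ℂ) * (starRingEnd ℂ (f.1 x - f.1 y) * g.1 x)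
      = ∑ x ∈ s, ∑ y ∈ s, (G.b x y : ℂ) * (starRingEnd ℂ (f.1 y - f.1 x) * g.1 y) := by
    rw [Finset.sum_comm]
    exact Finset.sum_congr rfl fun x _ => Finset.sum_congr rfl fun y _ => by rw [G.b_symm]
  have h3 : ∑ x ∈ s, ∑ y ∈ s,
      (G.b x y : ℂ) * (starRingEnd ℂ (f.1 x - f.1 y) * (g.1 x - g.1 y))
      = ∑ x ∈ s, ∑ y ∈ s, (G.b x y : ℂ) * (starRingEnd ℂ (f.1 x - f.1 y) * g.1 x)
        + ∑ x ∈ s, ∑ y ∈ s, (G.b x y : ℂ) * (starRingEnd ℂ (f.1 y - f.1 x) * g.1 y) := by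
    rw [← Finset.sum_add_distrib]
    refine Finset.sum_congr rfl fun x _ => ?_
    rw [← Finset.sum_add_distrib]
    refine Finset.sum_congr rfl fun y _ => ?_
    rw [map_sub, map_sub]
    ring
  rw [h1, h3, ← h2]
  ring

theorem exists_finset_nbhd (f g : G.minimalLaplacian.domain) : ∃ s : Finset X,
    (∀ x, f.1 x ≠ 0 ∨ g.1 x ≠ 0 → x ∈ s) ∧ ∀ x, f.1 x ≠ 0 ∨ g.1 x ≠ 0 → G.nbhd x ⊆ s := by
  classical
  have hf : (Function.support (f.1 : X → ℂ)).Finite := f.2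
  have hg : (Function.support (g.1 : X → ℂ)).Finite := g.2
  set t := hf.toFinset ∪ hg.toFinset with ht
  have hmem : ∀ x, f.1 x ≠ 0 ∨ g.1 x ≠ 0 → x ∈ t := fun x hx => by simpa [ht] using hx
  exact ⟨t ∪ t.biUnion G.nbhd, fun x hx => Finset.mem_union_left _ (hmem x hx), fun x hx =>
    (Finset.subset_biUnion_of_mem G.nbhd (hmem x hx)).trans Finset.subset_union_right⟩

theorem dense_finitelySupported : Dense (G.finitelySupported : Set G.ell2) := by
  rw [Submodule.dense_iff_topologicalClosure_eq_top, Submodule.topologicalClosure_eq_top_iff,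
    Submodule.eq_bot_iff]
  intro f hf
  refine G.ell2_ext fun x => ?_
  have hmem : G.single x ∈ G.finitelySupported := by
    refine (finite_support_single x 1).subset fun y hy => ?_
    rwa [Function.mem_support, single, ofFinite_apply] at hy
  have h1 := hf _ hmem
  rw [← inner_conj_symm, map_eq_zero, G.inner_eq_sum _ _ {x}] at h1
  · rw [Finset.sum_singleton, single, ofFinite_apply] at h1
    rw [ell2_zero_apply]
    simpa [(G.m_pos x).ne'] using h1
  · intro y hy
    rw [single, ofFinite_apply] at hy
    simpa using hy

theorem minimalLaplacian_isNonnegSymmetric : G.minimalLaplacian.IsNonnegSymmetric where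
  dense := G.dense_finitelySupported
  symm f g := by
    obtain ⟨s, hs, hs'⟩ := G.exists_finset_nbhd f g
    rw [← inner_conj_symm (f : G.ell2),
      G.inner_minimalLaplacian f g s (fun x hx => hs x (Or.inr hx)) fun x hx => hs' x (Or.inr hx),
      G.inner_minimalLaplacian g f s (fun x hx => hs x (Or.inl hx)) fun x hx => hs' x (Or.inl hx)]
    simp only [map_mul, map_sum, map_div₀, map_one, map_ofNat, Complex.conj_ofReal,
      Complex.conj_conj, map_sub]
    congr 1
    exact Finset.sum_congr rfl fun x _ => Finset.sum_congr rfl fun y _ => by ring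
  nonneg f := by
    obtain ⟨s, hs, hs'⟩ := G.exists_finset_nbhd f f
    rw [G.inner_minimalLaplacian f f s (fun x hx => hs x (Or.inr hx)) fun x hx => hs' x (Or.inr hx)]
    have h : ∀ x y, (G.b x y : ℂ) * (starRingEnd ℂ (f.1 x - f.1 y) * (f.1 x - f.1 y))
        = ((G.b x y * ‖f.1 x - f.1 y‖ ^ 2 : ℝ) : ℂ) := fun x y => by
      rw [Complex.conj_mul']
      push_cast
      rfl
    simp only [h, ← Complex.ofReal_sum]
    rw [show (1 / 2 : ℂ) = ((1 / 2 : ℝ) : ℂ) by push_cast; rfl, Complex.re_ofReal_mul,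
      Complex.ofReal_re]
    exact mul_nonneg (by norm_num) (Finset.sum_nonneg fun x _ => Finset.sum_nonneg fun y _ =>
      mul_nonneg (G.b_nonneg x y) (sq_nonneg _))

/-- The Laplacian `L` of the graph: the Friedrichs extension (the smallest self-adjoint extension)
of the formal Laplacian restricted to `C_c(X)`. -/
def laplacian : G.ell2 →ₗ.[ℂ] G.ell2 :=
  G.minimalLaplacian.friedrichs G.minimalLaplacian_isNonnegSymmetric

/-- The bounded operator `(L + 1)⁻¹`. -/
def resolvent : G.ell2 →L[ℂ] G.ell2 :=
  Classical.choose
    (G.minimalLaplacian.exists_friedrichs_resolvent G.minimalLaplacian_isNonnegSymmetric)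

theorem resolvent_eq_iff (f u : G.ell2) : G.resolvent f = u ↔
    ∃ hu : u ∈ G.laplacian.domain, G.laplacian ⟨u, hu⟩ + u = f :=
  Classical.choose_spec
    (G.minimalLaplacian.exists_friedrichs_resolvent G.minimalLaplacian_isNonnegSymmetric) f u

/-- The heat semigroup `e^{-tL}` for `t > 0`, defined by functional calculus. It is expressed
through the bounded self-adjoint operator `R = (L + 1)⁻¹`, whose spectrum lies in `[0, 1]`: since
`L = R⁻¹ - 1`, it is `h(R)` for the continuous function `h` with `h r = exp (-t (1 / r - 1))` for
`r > 0` and `h r = 0` for `r ≤ 0`. -/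
def heatSemigroup (t : ℝ) : G.ell2 →L[ℂ] G.ell2 :=
  cfc (fun r : ℝ => if 0 < r then Real.exp (-t * (1 / r - 1)) else 0) G.resolvent

/-- The heat kernel `p_t(x, y)`, `t > 0`, that is, the kernel with
`e^{-tL} f (x) = ∑_y p_t(x, y) f(y) m(y)`. Taking `f = 1_y` gives
`p_t(x, y) = (e^{-tL} 1_y)(x) / m(y)`, which is a real number. -/
def heatKernel (t : ℝ) (x y : X) : ℝ :=
  (G.heatSemigroup t (G.single y) x).re / G.m y

/-- The Green's function `g(x, y) = ∫_0^∞ p_t(x, y) dt`, with values in `[0, ∞]`. -/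
def green (x y : X) : ℝ≥0∞ :=
  ∫⁻ t in Set.Ioi (0 : ℝ), ENNReal.ofReal (G.heatKernel t x y)

/-- The total heat `∑_y p_t(x, y) m(y)`, with values in `[0, ∞]`. -/
def totalHeat (t : ℝ) (x : X) : ℝ≥0∞ :=
  ∑' y, ENNReal.ofReal (G.heatKernel t x y * G.m y)

/-- Stochastic incompleteness, read with "for some": heat is lost for some vertex and some time. -/
def StochasticallyIncompleteSome : Prop :=
  ∃ x : X, ∃ t > 0, G.totalHeat t x < 1

/-- Stochastic incompleteness, read with "for all": heat is lost for all vertices and times. -/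
def StochasticallyIncompleteAll : Prop :=
  ∀ x : X, ∀ t > 0, G.totalHeat t x < 1

/-- The Feller property, read with "for some": the heat kernel `p_t(x, ·)` vanishes at infinity
(that is, along the filter of complements of finite sets) for some vertex and some time. -/
def FellerSome : Prop :=
  ∃ x : X, ∃ t > 0, Tendsto (fun y => G.heatKernel t x y) cofinite (𝓝 0)

/-- The Feller property, read with "for all": the heat kernel `p_t(x, ·)` vanishes at infinity
for all vertices and times. -/
def FellerAll : Prop :=
  ∀ x : X, ∀ t > 0, Tendsto (fun y => G.heatKernel t x y) cofinite (𝓝 0)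

/-- Uniform transience: the Green's function is uniformly bounded on the diagonal. -/
def UniformlyTransient : Prop :=
  ∃ C : ℝ, 0 < C ∧ ∀ x : X, G.green x x ≤ ENNReal.ofReal C

variable {X' : Type*}

/-- A deck transformation of `π : X' → X`: an automorphism of the weighted graph `G'` that commutes
with `π`. -/
structure IsDeckTransformation (G' : WeightedGraph X') (π : X' → X) (γ : Equiv.Perm X') : Prop where
  proj : ∀ x, π (γ x) = π x
  weight : ∀ x y, G'.b (γ x) (γ y) = G'.b x y
  measure : ∀ x, G'.m (γ x) = G'.m x

/-- `π : X' → X` is a regular covering of the weighted graph `G` by `G'`: it is onto, maps the edges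
at each vertex `x` bijectively onto the edges at `π x`, preserves edge weights and vertex measure,
and the deck transformations act transitively on each fiber. -/
structure IsRegularCovering (G' : WeightedGraph X') (G : WeightedGraph X) (π : X' → X) : Prop where
  surjective : Function.Surjective π
  bijOn : ∀ x, Set.BijOn π {y | 0 < G'.b x y} {y | 0 < G.b (π x) y}
  weight : ∀ x y, 0 < G'.b x y → G'.b x y = G.b (π x) (π y)
  measure : ∀ x, G'.m x = G.m (π x)
  regular : ∀ x y, π x = π y → ∃ γ : Equiv.Perm X', G'.IsDeckTransformation π γ ∧ γ x = y

end WeightedGraph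

end

/-!
A regular covering relates the two heat kernels by `p_t(π x', y) = ∑_{π y' = y} p'_t(x', y')`
(`WeightedGraph.IsRegularCovering.isLift_heatSemigroup`), and all parts of the theorem are read off
from this identity. Summation over `y` shows that the total heat at `x'` and at `π x'` agree, which
settles stochastic incompleteness. The identity also gives `p'_t(x', y') ≤ p_t(π x', π y')` together
with summability over fibers, whence the Feller property and uniform transience pass to the
covering. With finitely many sheets all fibers have boundedly many points; the fiber sum is
controlled by its largest term for the Feller property, and by `n p'_t(x', x')` on the diagonal,
because positivity of the semigroup and invariance under deck transformations give
`p'_t(x', γ x') ≤ p'_t(x', x')`.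

The identity is proved first for the solution operators of `a u + s L u = f`. The Friedrichs solution
is the smallest nonnegative supersolution (`WeightedGraph.IsWeakSolution.re_le`), even among functions
outside `ℓ²`. So the lift of the solution `u` for `1_y` dominates the fiber sum of the solutions
upstairs; that sum is invariant under deck transformations, descends to a nonnegative solution on the
base, and hence dominates `u`.

Products and sums of operators inherit the identity, so it holds for the backward Euler
approximations `(1 + (t / N) (L + 1))⁻ᴺ`, which converge in norm to `E = e^{-t (L + 1)}`. In the limit
mass might escape along a fiber, and only `≤` survives. With `R = (L + 1)⁻¹`, the same applies to
`R - E R = ∫_0^t e^{-s (L + 1)} ds`, the limit of Riemann sums of Euler steps. But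
`R = (R - E R) + E R` satisfies the identity exactly, so no mass is lost in either summand, and since
the diagonal entries of `R` are positive, none is lost in `E`
(`WeightedGraph.IsSublift.isLift_of_add_mul`).
-/

noncomputable section

open scoped ComplexOrder

/-! ### The form of a nonnegative symmetric operator -/

namespace LinearPMap

variable {H : Type*} [NormedAddCommGroup H] [InnerProductSpace ℂ H]
  {S : H →ₗ.[ℂ] H} (hS : S.IsNonnegSymmetric)

include hS

theorem IsNonnegSymmetric.norm_inner_sq_le (a b : S.domain) :
    ‖⟪(a : H), S b⟫_ℂ‖ ^ 2 ≤ S.form a * S.form b := by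
  let c : PreInnerProductSpace.Core ℂ S.domain :=
    { inner := fun a b => ⟪(a : H), S b⟫_ℂ
      conj_inner_symm := fun a b => by rw [inner_conj_symm, hS.symm]
      re_inner_nonneg := fun a => by rw [← hS.symm]; exact hS.nonneg a
      add_left := fun a b c => by rw [Submodule.coe_add, inner_add_left]
      smul_left := fun a b r => by rw [Submodule.coe_smul, inner_smul_left] }
  have h := @InnerProductSpace.Core.inner_mul_inner_self_le ℂ S.domain _ _ _ c a b
  have h1 : ∀ a b : S.domain, @inner ℂ S.domain c.toInner a b = ⟪(a : H), S b⟫_ℂ := fun _ _ => rfl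
  have h2 : ‖⟪(b : H), S a⟫_ℂ‖ = ‖⟪(a : H), S b⟫_ℂ‖ := by
    rw [← hS.symm, ← inner_conj_symm, RCLike.norm_conj]
  simp only [h1, h2, ← hS.symm a a, ← hS.symm b b] at h
  rw [sq]
  exact h

/-- A vector of the form domain is a limit of vectors `φ n` of the domain of `S` along which the
pairing against `S ψ` converges at a rate governed by the form of `ψ` alone. -/
theorem IsNonnegSymmetric.exists_approx {u : H} (hu : u ∈ S.formDomain hS) :
    ∃ φ : ℕ → S.domain, Tendsto (fun n => (φ n : H)) atTop (𝓝 u) ∧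
      (∀ ε > 0, ∀ᶠ n in atTop, ∀ ψ : S.domain, ‖⟪u - φ n, S ψ⟫_ℂ‖ ^ 2 ≤ ε * S.form ψ) ∧
      ∃ C, ∀ᶠ n in atTop, S.form (φ n) ≤ C := by
  obtain ⟨φ, hφ, hφ'⟩ := hu
  refine ⟨φ, hφ, fun ε hε => ?_, ?_⟩
  · obtain ⟨N, hN⟩ := hφ' ε hε
    refine eventually_atTop.2 ⟨N, fun n hn ψ => ?_⟩
    have hlim : Tendsto (fun k => ‖⟪((φ k - φ n : S.domain) : H), S ψ⟫_ℂ‖ ^ 2) atTop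
        (𝓝 (‖⟪u - φ n, S ψ⟫_ℂ‖ ^ 2)) :=
      (((hφ.sub_const _).inner tendsto_const_nhds).norm).pow 2
    refine le_of_tendsto hlim (eventually_atTop.2 ⟨N, fun k hk => ?_⟩)
    exact (hS.norm_inner_sq_le _ _).trans
      (mul_le_mul_of_nonneg_right (hN k hk n hn).le (hS.nonneg ψ))
  · obtain ⟨N, hN⟩ := hφ' 1 one_pos
    refine ⟨2 + 2 * S.form (φ N), eventually_atTop.2 ⟨N, fun n hn => ?_⟩⟩
    have h1 := S.form_add_add_form_sub (φ n - φ N) (φ N)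
    have h2 : 0 ≤ S.form (φ n - φ N - φ N) := hS.nonneg _
    rw [sub_add_cancel] at h1
    linarith [hN n hn N le_rfl]

/-- The form of the Friedrichs extension is real valued. -/
theorem IsNonnegSymmetric.im_inner_eq_zero {u g : H} (hu : u ∈ S.formDomain hS)
    (h : ∀ φ : S.domain, ⟪g, (φ : H)⟫_ℂ = ⟪u, S φ⟫_ℂ) : (⟪g, u⟫_ℂ).im = 0 := by
  obtain ⟨φ, hφ, happ, C, hC⟩ := hS.exists_approx hu
  have hlim : Tendsto (fun n => (⟪g, (φ n : H)⟫_ℂ).im ^ 2) atTop (𝓝 ((⟪g, u⟫_ℂ).im ^ 2)) :=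
    ((Complex.continuous_im.tendsto _).comp (tendsto_const_nhds.inner hφ)).pow 2
  refine pow_eq_zero_iff two_ne_zero |>.1 (le_antisymm ?_ (sq_nonneg _))
  refine le_of_forall_pos_le_add fun ε hε => ?_
  rw [zero_add]
  refine le_of_tendsto hlim ?_
  filter_upwards [happ (ε / (|C| + 1)) (by positivity), hC] with n hn hCn
  have h0 : (⟪(φ n : H), S (φ n)⟫_ℂ).im = 0 := by
    have := inner_conj_symm (𝕜 := ℂ) (φ n : H) (S (φ n))
    rw [hS.symm] at this
    exact Complex.conj_eq_iff_im.1 this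
  have h1 : (⟪g, (φ n : H)⟫_ℂ).im = (⟪u - φ n, S (φ n)⟫_ℂ).im := by
    rw [h, inner_sub_left, Complex.sub_im, h0, sub_zero]
  have h2 : (⟪u - φ n, S (φ n)⟫_ℂ).im ^ 2 ≤ ‖⟪u - φ n, S (φ n)⟫_ℂ‖ ^ 2 :=
    sq_le_sq' (by linarith [neg_abs_le (⟪u - φ n, S (φ n)⟫_ℂ).im,
      Complex.abs_im_le_norm ⟪u - φ n, S (φ n)⟫_ℂ])
      (Complex.im_le_norm _)
  rw [h1]
  refine h2.trans ((hn (φ n)).trans ?_)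
  calc ε / (|C| + 1) * S.form (φ n) ≤ ε / (|C| + 1) * (|C| + 1) := by
        gcongr
        linarith [le_abs_self C]
    _ = ε := by field_simp

end LinearPMap

namespace WeightedGraph

variable {X : Type*} (G : WeightedGraph X)

/-- `u = (L + 1)⁻¹ f` in weak form: `u` lies in the form domain and solves the equation against
finitely supported functions. -/
theorem resolvent_weak (f : G.ell2) :
    G.resolvent f ∈ G.minimalLaplacian.formDomain G.minimalLaplacian_isNonnegSymmetric ∧
      ∀ φ : G.minimalLaplacian.domain,
        ⟪f - G.resolvent f, (φ : G.ell2)⟫_ℂ = ⟪G.resolvent f, G.minimalLaplacian φ⟫_ℂ := by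
  obtain ⟨hu, h⟩ := (G.resolvent_eq_iff f (G.resolvent f)).1 rfl
  exact (LinearPMap.mem_friedrichs_iff _ _ _ _).1 ⟨hu, eq_sub_of_add_eq h⟩

theorem resolvent_nonneg : 0 ≤ G.resolvent := by
  rw [ContinuousLinearMap.nonneg_iff_isPositive, ContinuousLinearMap.isPositive_iff_complex]
  intro f
  obtain ⟨hu, h⟩ := G.resolvent_weak f
  set u := G.resolvent f
  have h1 := G.minimalLaplacian_isNonnegSymmetric.im_inner_eq_zero hu h
  have h2 := G.minimalLaplacian.friedrichs_nonneg G.minimalLaplacian_isNonnegSymmetric hu h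
  have h3 : ⟪u, u⟫_ℂ = ((‖u‖ ^ 2 : ℝ) : ℂ) := by
    rw [inner_self_eq_norm_sq_to_K]
    push_cast
    rfl
  rw [inner_sub_left, h3] at h1 h2
  rw [Complex.sub_re, Complex.ofReal_re] at h2
  rw [Complex.sub_im, Complex.ofReal_im, sub_zero] at h1
  have h4 : (⟪u, f⟫_ℂ).re = (⟪f, u⟫_ℂ).re := inner_re_symm (𝕜 := ℂ) _ _
  have h5 : (⟪u, f⟫_ℂ).im = 0 := by rw [← inner_conj_symm, Complex.conj_im, h1, neg_zero]
  refine ⟨Complex.ext rfl h5.symm, ?_⟩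
  change 0 ≤ (⟪u, f⟫_ℂ).re
  rw [h4]
  linarith [sq_nonneg ‖u‖]

end WeightedGraph

/-! ### Weak solutions and their minimality -/

namespace WeightedGraph

variable {X : Type*} (G : WeightedGraph X)

theorem single_apply_self (x : X) : G.single x x = 1 := by
  rw [single, ofFinite_apply]
  simp

theorem single_apply_of_ne {x y : X} (h : y ≠ x) : G.single x y = 0 := by
  rw [single, ofFinite_apply]
  simp [h]

theorem inner_single (f : G.ell2) (x : X) :
    ⟪f, G.single x⟫_ℂ = (G.m x : ℂ) * starRingEnd ℂ (f x) := by
  rw [G.inner_eq_sum _ _ {x} fun y hy => ?_]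
  · simp [single_apply_self]
  · by_contra h
    exact hy (G.single_apply_of_ne (by simpa using h))

theorem single_inner (f : G.ell2) (x : X) :
    ⟪G.single x, f⟫_ℂ = (G.m x : ℂ) * f x := by
  rw [← inner_conj_symm, inner_single, map_mul, Complex.conj_ofReal, Complex.conj_conj]

theorem eval_eq_inner (f : G.ell2) (x : X) : f x = (G.m x : ℂ)⁻¹ * ⟪G.single x, f⟫_ℂ := by
  have hm : (G.m x : ℂ) ≠ 0 := by exact_mod_cast (G.m_pos x).ne'
  rw [single_inner]
  field_simp

theorem tendsto_eval {ι : Type*} {l : Filter ι} {F : ι → G.ell2} {f : G.ell2}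
    (h : Tendsto F l (𝓝 f)) (x : X) : Tendsto (fun i => F i x) l (𝓝 (f x)) := by
  simp only [eval_eq_inner]
  exact (tendsto_const_nhds.inner h).const_mul _

theorem ell2_sub_apply (f g : G.ell2) (x : X) : (f - g) x = f x - g x := by
  rw [sub_eq_add_neg, ell2_add_apply, ← neg_one_smul ℂ, ell2_smul_apply]
  ring

theorem ell2_sum_apply {ι : Type*} (s : Finset ι) (F : ι → G.ell2) (x : X) :
    (∑ i ∈ s, F i) x = ∑ i ∈ s, F i x := by
  classical
  induction s using Finset.induction_on with
  | empty => simp [ell2_zero_apply]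
  | insert i s hi ih => rw [Finset.sum_insert hi, Finset.sum_insert hi, ell2_add_apply, ih]

theorem hasSum_inner (f g : G.ell2) :
    HasSum (fun x => (G.m x : ℂ) * (starRingEnd ℂ (f x) * g x)) ⟪f, g⟫_ℂ := by
  let _ : MeasurableSpace X := ⊤
  have hdef : ⟪f, g⟫_ℂ = ∫ x, ⟪f x, g x⟫_ℂ ∂G.measure :=
    L2.inner_def (𝕜 := ℂ) (μ := G.measure) (f : Lp ℂ 2 G.measure) g
  have hint : Integrable (fun x => ⟪f x, g x⟫_ℂ) G.measure :=
    L2.integrable_inner (𝕜 := ℂ) (μ := G.measure) (f : Lp ℂ 2 G.measure) g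
  rw [hdef]
  convert! hasSum_integral_measure hint using 2 with x
  rw [integral_smul_measure, integral_dirac, ENNReal.toReal_ofReal (G.m_pos x).le,
    RCLike.inner_apply, Complex.real_smul]
  ring

/-- The formal Laplacian of a real function. -/
def realLaplacian (v : X → ℝ) (x : X) : ℝ :=
  (1 / G.m x) * ∑ y ∈ G.nbhd x, G.b x y * (v x - v y)

theorem formalLaplacian_re (f : X → ℂ) (x : X) :
    (G.formalLaplacian f x).re = G.realLaplacian (fun y => (f y).re) x := by
  rw [formalLaplacian, realLaplacian,
    show (1 / (G.m x : ℂ)) = ((1 / G.m x : ℝ) : ℂ) by push_cast; rfl, Complex.re_ofReal_mul,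
    Complex.re_sum]
  simp only [Complex.re_ofReal_mul, Complex.sub_re]

theorem realLaplacian_sub (v w : X → ℝ) (x : X) :
    G.realLaplacian (fun y => v y - w y) x = G.realLaplacian v x - G.realLaplacian w x := by
  simp only [realLaplacian, ← mul_sub, ← Finset.sum_sub_distrib]
  congr 1
  exact Finset.sum_congr rfl fun y _ => by ring

theorem realLaplacian_zero (x : X) : G.realLaplacian (fun _ => 0) x = 0 := by
  simp [realLaplacian]

/-- Truncation to the positive part does not increase `⟨𝓛 d, d₊⟩`. -/
theorem posPart_mul_realLaplacian_le (d : X → ℝ) (x : X) :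
    max (d x) 0 * G.realLaplacian (fun y => max (d y) 0) x ≤ max (d x) 0 * G.realLaplacian d x := by
  rcases le_or_gt (d x) 0 with h | h
  · simp [max_eq_right h]
  · refine mul_le_mul_of_nonneg_left ?_ (le_max_right _ _)
    refine mul_le_mul_of_nonneg_left (Finset.sum_le_sum fun y _ => ?_)
      (one_div_nonneg.2 (G.m_pos x).le)
    refine mul_le_mul_of_nonneg_left ?_ (G.b_nonneg x y)
    simp only [max_eq_left h.le]
    linarith [le_max_left (d y) 0]

/-- `u` solves `a u + s L u = f` weakly, for the Friedrichs extension `L`: it lies in the form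
domain, and the equation holds against all finitely supported functions. -/
structure IsWeakSolution (a s : ℝ) (f u : G.ell2) : Prop where
  mem : u ∈ G.minimalLaplacian.formDomain G.minimalLaplacian_isNonnegSymmetric
  eq : ∀ φ : G.minimalLaplacian.domain,
    ⟪f - (a : ℂ) • u, (φ : G.ell2)⟫_ℂ = s * ⟪u, G.minimalLaplacian φ⟫_ℂ

theorem re_inner_eq_sum (f g : G.ell2) (w : X → ℝ) (hg : ∀ x, g x = w x) (t : Finset X)
    (ht : ∀ x, w x ≠ 0 → x ∈ t) :
    (⟪f, g⟫_ℂ).re = ∑ x ∈ t, G.m x * ((f x).re * w x) := by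
  rw [G.inner_eq_sum f g t fun x hx => ht x fun h => hx (by rw [hg, h, Complex.ofReal_zero]),
    Complex.re_sum]
  refine Finset.sum_congr rfl fun x _ => ?_
  rw [hg, Complex.re_ofReal_mul, Complex.re_mul_ofReal, Complex.conj_re]

variable {G}

theorem IsWeakSolution.smul {a s : ℝ} {f u : G.ell2} (h : G.IsWeakSolution a s f u) (c : ℂ) :
    G.IsWeakSolution a s (c • f) (c • u) where
  mem := Submodule.smul_mem _ c h.mem
  eq φ := by
    rw [smul_comm, ← smul_sub, inner_smul_left, inner_smul_left, h.eq]
    ring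

theorem IsWeakSolution.sum {ι : Type*} (t : Finset ι) {a s : ℝ} {f u : ι → G.ell2}
    (h : ∀ i ∈ t, G.IsWeakSolution a s (f i) (u i)) :
    G.IsWeakSolution a s (∑ i ∈ t, f i) (∑ i ∈ t, u i) where
  mem := Submodule.sum_mem _ fun i hi => (h i hi).mem
  eq φ := by
    rw [Finset.smul_sum, ← Finset.sum_sub_distrib, sum_inner, sum_inner, Finset.mul_sum]
    exact Finset.sum_congr rfl fun i hi => (h i hi).eq φ

/-- Weak solutions solve the equation pointwise. -/
theorem IsWeakSolution.pointwise {a s : ℝ} {f u : G.ell2} (h : G.IsWeakSolution a s f u) (x : X) :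
    a * u x + s * G.formalLaplacian u x = f x := by
  obtain ⟨φ, hφ, -, -⟩ := G.minimalLaplacian_isNonnegSymmetric.exists_approx h.mem
  have hmem : G.single x ∈ G.minimalLaplacian.domain := by
    refine (finite_support_single x 1).subset fun y hy => ?_
    rwa [Function.mem_support, single, ofFinite_apply] at hy
  have h1 := h.eq ⟨G.single x, hmem⟩
  have h2 : ⟪u, G.minimalLaplacian ⟨G.single x, hmem⟩⟫_ℂ
      = (G.m x : ℂ) * starRingEnd ℂ (G.formalLaplacian u x) := by
    have e1 : Tendsto (fun n => ⟪(φ n : G.ell2), G.minimalLaplacian ⟨G.single x, hmem⟩⟫_ℂ) atTop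
        (𝓝 ⟪u, G.minimalLaplacian ⟨G.single x, hmem⟩⟫_ℂ) := hφ.inner tendsto_const_nhds
    refine tendsto_nhds_unique e1 ?_
    simp only [← G.minimalLaplacian_isNonnegSymmetric.symm, inner_single, minimalLaplacian_apply]
    refine Tendsto.const_mul _ ((Complex.continuous_conj.tendsto _).comp ?_)
    refine Tendsto.const_mul _ (tendsto_finsetSum _ fun y _ => Tendsto.const_mul _ ?_)
    exact (G.tendsto_eval hφ x).sub (G.tendsto_eval hφ y)
  have hm : (G.m x : ℂ) ≠ 0 := by exact_mod_cast (G.m_pos x).ne'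
  rw [h2, inner_single, mul_left_comm] at h1
  have h3 := congrArg (starRingEnd ℂ) (mul_left_cancel₀ hm h1)
  simp only [map_mul, Complex.conj_conj, Complex.conj_ofReal] at h3
  rw [ell2_sub_apply, ell2_smul_apply] at h3
  rw [← h3]
  ring

/-- **Minimality of the Friedrichs solution.** A weak solution of `a u + s L u = f` lies below every
nonnegative supersolution `v` of the formal equation, which need not belong to `ℓ²`. The reason is
that the truncations `(φ - v)₊`, for finitely supported `φ` approximating `u`, are themselves
finitely supported, so that they may be used as test functions. -/
theorem IsWeakSolution.re_le {a s : ℝ} (ha : 0 < a) (hs : 0 < s) {f u : G.ell2}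
    (h : G.IsWeakSolution a s f u) {v : X → ℝ} (hv0 : ∀ x, 0 ≤ v x)
    (hv : ∀ x, (f x).re ≤ a * v x + s * G.realLaplacian v x) (x : X) : (u x).re ≤ v x := by
  have hS := G.minimalLaplacian_isNonnegSymmetric
  obtain ⟨φ, hφ, happ, -⟩ := hS.exists_approx h.mem
  set w : ℕ → X → ℝ := fun n y => max (((φ n : G.ell2) y).re - v y) 0 with hw
  have hfin : ∀ n, (Function.support fun y => (w n y : ℂ)).Finite := fun n => by
    refine (show (Function.support ((φ n : G.ell2) : X → ℂ)).Finite from (φ n).2).subset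
      fun y hy => ?_
    contrapose! hy
    simp only [Function.mem_support, not_not] at hy ⊢
    simp [hw, hy, hv0]
  have hmem : ∀ n, G.ofFinite _ (hfin n) ∈ G.minimalLaplacian.domain := fun n =>
    (hfin n).subset fun y hy => by rwa [Function.mem_support, ofFinite_apply] at hy
  set ψ : ℕ → G.minimalLaplacian.domain := fun n => ⟨G.ofFinite _ (hfin n), hmem n⟩
  have hψw : ∀ n y, (ψ n : G.ell2) y = w n y := fun n y => G.ofFinite_apply _ (hfin n) y
  have ht : ∀ n y, w n y ≠ 0 → y ∈ (hfin n).toFinset := fun n y hy => by simpa using hy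
  -- Testing the equation with `ψ n` bounds the norm of `ψ n` by the distance from `φ n` to `u`.
  have key : ∀ n, a * ‖(ψ n : G.ell2)‖ ^ 2 + s * G.minimalLaplacian.form (ψ n)
      ≤ a * (⟪(φ n : G.ell2) - u, (ψ n : G.ell2)⟫_ℂ).re
        - s * (⟪u - φ n, G.minimalLaplacian (ψ n)⟫_ℂ).re := by
    intro n
    have e1 := congrArg Complex.re (h.eq (ψ n))
    rw [inner_sub_left, inner_smul_left, Complex.conj_ofReal, Complex.sub_re,
      Complex.re_ofReal_mul, Complex.re_ofReal_mul,
      G.re_inner_eq_sum f _ _ (hψw n) _ (ht n)] at e1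
    have e2 := G.re_inner_eq_sum (φ n) _ _ (hψw n) _ (ht n)
    have e3 : (⟪(φ n : G.ell2), G.minimalLaplacian (ψ n)⟫_ℂ).re = ∑ y ∈ (hfin n).toFinset,
        G.m y * (G.realLaplacian (fun y => ((φ n : G.ell2) y).re) y * w n y) := by
      rw [← hS.symm, G.re_inner_eq_sum _ _ _ (hψw n) _ (ht n)]
      simp only [minimalLaplacian_apply, formalLaplacian_re]
    have e4 : ‖(ψ n : G.ell2)‖ ^ 2 = ∑ y ∈ (hfin n).toFinset, G.m y * (w n y * w n y) := by
      rw [← inner_self_eq_norm_sq (𝕜 := ℂ), RCLike.re_to_complex,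
        G.re_inner_eq_sum _ _ _ (hψw n) _ (ht n)]
      simp only [hψw, Complex.ofReal_re]
    have e5 : G.minimalLaplacian.form (ψ n) = ∑ y ∈ (hfin n).toFinset,
        G.m y * (G.realLaplacian (w n) y * w n y) := by
      rw [LinearPMap.form, G.re_inner_eq_sum _ _ _ (hψw n) _ (ht n)]
      simp only [minimalLaplacian_apply, formalLaplacian_re, hψw, Complex.ofReal_re]
    have e6 : a * ∑ y ∈ (hfin n).toFinset, G.m y * (w n y * w n y)
        + s * ∑ y ∈ (hfin n).toFinset, G.m y * (G.realLaplacian (w n) y * w n y)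
        + ∑ y ∈ (hfin n).toFinset, G.m y * ((f y).re * w n y)
        ≤ a * ∑ y ∈ (hfin n).toFinset, G.m y * (((φ n : G.ell2) y).re * w n y)
        + s * ∑ y ∈ (hfin n).toFinset,
          G.m y * (G.realLaplacian (fun y => ((φ n : G.ell2) y).re) y * w n y) := by
      simp only [Finset.mul_sum, ← Finset.sum_add_distrib]
      refine Finset.sum_le_sum fun y _ => ?_
      have c1 := G.posPart_mul_realLaplacian_le (fun y => ((φ n : G.ell2) y).re - v y) y
      rw [realLaplacian_sub] at c1
      change w n y * G.realLaplacian (w n) y ≤ w n y * _ at c1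
      have c2 : w n y * w n y = w n y * (((φ n : G.ell2) y).re - v y) := by
        simp only [hw]
        rcases le_total (((φ n : G.ell2) y).re - v y) 0 with hle | hle
        · simp [max_eq_right hle]
        · simp [max_eq_left hle]
      have c3 : 0 ≤ w n y := le_max_right _ _
      have c4 := mul_le_mul_of_nonneg_right (hv y) c3
      have c5 := mul_le_mul_of_nonneg_left c1 hs.le
      have c6 : a * (w n y * w n y) + s * (G.realLaplacian (w n) y * w n y) + (f y).re * w n y
          ≤ a * (((φ n : G.ell2) y).re * w n y)
            + s * (G.realLaplacian (fun y => ((φ n : G.ell2) y).re) y * w n y) := by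
        rw [c2]
        linarith
      calc _ = G.m y * (a * (w n y * w n y) + s * (G.realLaplacian (w n) y * w n y)
            + (f y).re * w n y) := by ring
        _ ≤ G.m y * _ := mul_le_mul_of_nonneg_left c6 (G.m_pos y).le
        _ = _ := by ring
    rw [inner_sub_left, inner_sub_left, Complex.sub_re, Complex.sub_re, e2, e3, e4, e5]
    linarith
  have hx : ∀ n, G.m x * w n x ^ 2 ≤ ‖(ψ n : G.ell2)‖ ^ 2 := by
    intro n
    have h1 : ‖⟪(ψ n : G.ell2), G.single x⟫_ℂ‖ ≤ ‖(ψ n : G.ell2)‖ * ‖G.single x‖ :=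
      norm_inner_le_norm _ _
    have h2 : ‖G.single x‖ ^ 2 = G.m x := by
      rw [← inner_self_eq_norm_sq (𝕜 := ℂ), inner_single, single_apply_self]
      simp
    rw [inner_single, hψw, Complex.conj_ofReal, ← Complex.ofReal_mul, Complex.norm_real,
      Real.norm_eq_abs] at h1
    have h3 := pow_le_pow_left₀ (abs_nonneg _) h1 2
    rw [sq_abs, mul_pow, mul_pow, h2] at h3
    have := G.m_pos x
    nlinarith
  have hlim : Tendsto (fun n => G.m x * w n x ^ 2) atTop (𝓝 (G.m x * max ((u x).re - v x) 0 ^ 2)) :=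
    ((((((Complex.continuous_re.tendsto _).comp (G.tendsto_eval hφ x)).sub_const _).max
      tendsto_const_nhds).pow 2).const_mul _)
  have hlim0 : G.m x * max ((u x).re - v x) 0 ^ 2 ≤ 0 := by
    refine le_of_forall_pos_le_add fun δ hδ => ?_
    rw [zero_add]
    refine le_of_tendsto hlim ?_
    have hdist : Tendsto (fun n => ‖(φ n : G.ell2) - u‖ ^ 2) atTop (𝓝 0) := by
      have := (tendsto_iff_norm_sub_tendsto_zero.1 hφ).pow 2
      simpa using this
    filter_upwards [happ (a * δ / s) (by positivity),
      hdist.eventually (gt_mem_nhds (half_pos hδ))] with n hn1 hn2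
    refine (hx n).trans ?_
    set F := G.minimalLaplacian.form (ψ n)
    have hF : 0 ≤ F := hS.nonneg _
    set A := ‖(ψ n : G.ell2)‖
    set p := ‖(φ n : G.ell2) - u‖
    set D := (⟪u - φ n, G.minimalLaplacian (ψ n)⟫_ℂ).re
    have k1 : (⟪(φ n : G.ell2) - u, (ψ n : G.ell2)⟫_ℂ).re ≤ p * A :=
      re_inner_le_norm (𝕜 := ℂ) _ _
    have k2 : D ^ 2 ≤ a * δ / s * F := by
      refine le_trans ?_ (hn1 (ψ n))
      rw [← sq_abs]
      exact pow_le_pow_left₀ (abs_nonneg _) (Complex.abs_re_le_norm _) 2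
    have k3 : -D ≤ a * δ / s / 4 + F := by
      refine le_of_sq_le_sq ?_ (by positivity)
      nlinarith [sq_nonneg (a * δ / s / 4 - F)]
    have k4 : s * -D ≤ a * δ / 4 + s * F := by
      calc s * -D ≤ s * (a * δ / s / 4 + F) := mul_le_mul_of_nonneg_left k3 hs.le
        _ = _ := by field_simp
    have k5 : a * A ^ 2 ≤ a * (p * A + δ / 4) := by
      have := key n
      have := mul_le_mul_of_nonneg_left k1 ha.le
      linarith
    have k6 := le_of_mul_le_mul_left k5 ha
    nlinarith [sq_nonneg (p - A)]
  have h0 : max ((u x).re - v x) 0 ^ 2 ≤ 0 := by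
    by_contra hc
    push Not at hc
    linarith [mul_pos (G.m_pos x) hc]
  have h1 := pow_eq_zero_iff two_ne_zero |>.1 (le_antisymm h0 (sq_nonneg _))
  linarith [le_max_left ((u x).re - v x) 0]

/-- Weak solutions with a nonnegative right-hand side are nonnegative, in particular real. -/
theorem IsWeakSolution.nonneg {a s : ℝ} (ha : 0 < a) (hs : 0 < s) {f u : G.ell2}
    (h : G.IsWeakSolution a s f u) (hf : ∀ x, 0 ≤ f x) (x : X) : 0 ≤ u x := by
  have aux : ∀ c : ℂ, (∀ y, (c * f y).re ≤ 0) → (c * u x).re ≤ 0 := fun c hc => by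
    have := (h.smul c).re_le ha hs (v := fun _ => 0) (fun _ => le_rfl)
      (fun y => by rw [ell2_smul_apply, realLaplacian_zero]; simpa using hc y) x
    rwa [ell2_smul_apply] at this
  have him : ∀ y, (f y).im = 0 := fun y => (Complex.le_def.1 (hf y)).2.symm
  have hre : ∀ y, 0 ≤ (f y).re := fun y => (Complex.le_def.1 (hf y)).1
  have h1 := aux (-1) fun y => by simpa using hre y
  have h2 := aux Complex.I fun y => by simp [him]
  have h3 := aux (-Complex.I) fun y => by simp [him]
  rw [Complex.le_def]
  simp at h1 h2 h3
  exact ⟨h1, le_antisymm h2 h3 |>.symm ▸ rfl⟩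

end WeightedGraph

/-! ### Matrices of bounded operators and lifts along a map -/

namespace WeightedGraph

section Entries

variable {X : Type*} {G : WeightedGraph X}

/-- `A f (x) = ∑_z (A 1_z)(x) f(z)`: a bounded operator on `ℓ²(X, m)` acts through its matrix. -/
theorem hasSum_apply (A : G.ell2 →L[ℂ] G.ell2) (g : G.ell2) (x : X) :
    HasSum (fun z => A (G.single z) x * g z) (A g x) := by
  have hm : (G.m x : ℂ) ≠ 0 := by exact_mod_cast (G.m_pos x).ne'
  have h := (G.hasSum_inner (ContinuousLinearMap.adjoint A (G.single x)) g).mul_left (G.m x : ℂ)⁻¹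
  rw [ContinuousLinearMap.adjoint_inner_left, ← eval_eq_inner] at h
  convert! h using 2 with z
  rw [← mul_assoc (G.m z : ℂ), ← inner_single, ContinuousLinearMap.adjoint_inner_left,
    single_inner]
  field_simp

/-- The matrix `(A 1_y)(x)` of `A` has real nonnegative entries. -/
def HasNonnegEntries (A : G.ell2 →L[ℂ] G.ell2) : Prop :=
  ∀ x y, 0 ≤ A (G.single y) x

/-- The matrix entry `(A 1_y)(x)` as an element of `[0, ∞]`. This is the kernel of `A` multiplied by
`m y`, so that composition of operators is matrix multiplication. It is meaningful for operators
with nonnegative entries. -/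
def entry (A : G.ell2 →L[ℂ] G.ell2) (x y : X) : ℝ≥0∞ :=
  ENNReal.ofReal (A (G.single y) x).re

theorem entry_ne_top (A : G.ell2 →L[ℂ] G.ell2) (x y : X) : entry A x y ≠ ⊤ :=
  ENNReal.ofReal_ne_top

theorem HasNonnegEntries.re_nonneg {A : G.ell2 →L[ℂ] G.ell2} (hA : HasNonnegEntries A) (x y : X) :
    0 ≤ (A (G.single y) x).re :=
  (Complex.le_def.1 (hA x y)).1

theorem HasNonnegEntries.coe_re {A : G.ell2 →L[ℂ] G.ell2} (hA : HasNonnegEntries A) (x y : X) :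
    (((A (G.single y) x).re : ℝ) : ℂ) = A (G.single y) x :=
  Complex.ext rfl (Complex.le_def.1 (hA x y)).2

variable {A B : G.ell2 →L[ℂ] G.ell2}

theorem HasNonnegEntries.add (hA : HasNonnegEntries A) (hB : HasNonnegEntries B) :
    HasNonnegEntries (A + B) := fun x y => by
  rw [_root_.add_apply, ell2_add_apply]
  exact add_nonneg (hA x y) (hB x y)

theorem HasNonnegEntries.smul (hA : HasNonnegEntries A) {c : ℝ} (hc : 0 ≤ c) :
    HasNonnegEntries ((c : ℂ) • A) := fun x y => by
  rw [_root_.smul_apply, ell2_smul_apply]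
  exact mul_nonneg (by exact_mod_cast hc) (hA x y)

theorem HasNonnegEntries.mul (hA : HasNonnegEntries A) (hB : HasNonnegEntries B) :
    HasNonnegEntries (A * B) := fun x y => by
  rw [mul_apply_eq_comp]
  exact (hasSum_apply A (B (G.single y)) x).nonneg fun z => mul_nonneg (hA x z) (hB z y)

theorem entry_add (hA : HasNonnegEntries A) (hB : HasNonnegEntries B) (x y : X) :
    entry (A + B) x y = entry A x y + entry B x y := by
  rw [entry, _root_.add_apply, ell2_add_apply, Complex.add_re,
    ENNReal.ofReal_add (hA.re_nonneg x y) (hB.re_nonneg x y)]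
  rfl

theorem entry_smul {c : ℝ} (hc : 0 ≤ c) (x y : X) :
    entry ((c : ℂ) • A) x y = ENNReal.ofReal c * entry A x y := by
  rw [entry, _root_.smul_apply, ell2_smul_apply, Complex.re_ofReal_mul,
    ENNReal.ofReal_mul hc]
  rfl

theorem entry_mul (hA : HasNonnegEntries A) (hB : HasNonnegEntries B) (x y : X) :
    entry (A * B) x y = ∑' z, entry A x z * entry B z y := by
  have h := Complex.hasSum_re (hasSum_apply A (B (G.single y)) x)
  have h1 : ∀ z, (A (G.single z) x * B (G.single y) z).re
      = (A (G.single z) x).re * (B (G.single y) z).re := fun z => by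
    rw [← hA.coe_re x z, Complex.re_ofReal_mul, Complex.ofReal_re]
  simp only [h1] at h
  rw [entry, mul_apply_eq_comp, ← h.tsum_eq, ENNReal.ofReal_tsum_of_nonneg
    (fun z => mul_nonneg (hA.re_nonneg x z) (hB.re_nonneg z y)) h.summable]
  exact tsum_congr fun z => ENNReal.ofReal_mul (hA.re_nonneg x z)

variable {ι : Type*} {l : Filter ι} {F : ι → G.ell2 →L[ℂ] G.ell2}

theorem tendsto_apply_single (h : Tendsto F l (𝓝 A)) (x y : X) :
    Tendsto (fun i => F i (G.single y) x) l (𝓝 (A (G.single y) x)) :=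
  G.tendsto_eval (((ContinuousLinearMap.apply ℂ G.ell2 (G.single y)).continuous.tendsto A).comp h) x

theorem tendsto_entry (h : Tendsto F l (𝓝 A)) (x y : X) :
    Tendsto (fun i => entry (F i) x y) l (𝓝 (entry A x y)) :=
  ENNReal.tendsto_ofReal ((Complex.continuous_re.tendsto _).comp (tendsto_apply_single h x y))

theorem HasNonnegEntries.of_tendsto [l.NeBot] (h : Tendsto F l (𝓝 A))
    (hF : ∀ᶠ i in l, HasNonnegEntries (F i)) : HasNonnegEntries A := fun x y =>
  ge_of_tendsto (tendsto_apply_single h x y) (hF.mono fun _ hi => hi x y)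

end Entries

section Lifts

variable {X X' : Type*} {G : WeightedGraph X} {G' : WeightedGraph X'} {π : X' → X}

/-- `A'` lifts `A` along `π`: the entries are nonnegative, and the entries of `A` are obtained from
those of `A'` by summation over the fibers of `π`. -/
structure IsLift (π : X' → X) (A' : G'.ell2 →L[ℂ] G'.ell2) (A : G.ell2 →L[ℂ] G.ell2) : Prop where
  nonneg' : HasNonnegEntries A'
  nonneg : HasNonnegEntries A
  tsum_eq : ∀ x' y, ∑' y' : π ⁻¹' {y}, entry A' x' y' = entry A (π x') y

/-- The weakening of `IsLift` to an inequality, which is what remains of `IsLift` after a limit in the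
operator norm. -/
structure IsSublift (π : X' → X) (A' : G'.ell2 →L[ℂ] G'.ell2) (A : G.ell2 →L[ℂ] G.ell2) :
    Prop where
  nonneg' : HasNonnegEntries A'
  nonneg : HasNonnegEntries A
  tsum_le : ∀ x' y, ∑' y' : π ⁻¹' {y}, entry A' x' y' ≤ entry A (π x') y

variable {A' B' : G'.ell2 →L[ℂ] G'.ell2} {A B : G.ell2 →L[ℂ] G.ell2}

theorem IsLift.add (hA : IsLift π A' A) (hB : IsLift π B' B) : IsLift π (A' + B') (A + B) where
  nonneg' := hA.nonneg'.add hB.nonneg'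
  nonneg := hA.nonneg.add hB.nonneg
  tsum_eq x y := by
    simp only [entry_add hA.nonneg hB.nonneg, entry_add hA.nonneg' hB.nonneg', ENNReal.tsum_add,
      hA.tsum_eq, hB.tsum_eq]

theorem IsLift.smul (hA : IsLift π A' A) {c : ℝ} (hc : 0 ≤ c) :
    IsLift π ((c : ℂ) • A') ((c : ℂ) • A) where
  nonneg' := hA.nonneg'.smul hc
  nonneg := hA.nonneg.smul hc
  tsum_eq x y := by
    simp only [entry_smul hc, ENNReal.tsum_mul_left, hA.tsum_eq]

/-- Multiplying by a lift from the right, the sum over a fiber is taken first over the fibers of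
the intermediate vertex. -/
theorem tsum_entry_mul (hA' : HasNonnegEntries A') (hB : IsLift π B' B) (x' : X') (y : X) :
    ∑' y' : π ⁻¹' {y}, entry (A' * B') x' y'
      = ∑' z, (∑' z' : π ⁻¹' {z}, entry A' x' z') * entry B z y := by
  simp only [entry_mul hA' hB.nonneg']
  rw [ENNReal.tsum_comm]
  simp only [ENNReal.tsum_mul_left, hB.tsum_eq]
  rw [← ENNReal.tsum_fiberwise _ π]
  refine tsum_congr fun z => ?_
  rw [← ENNReal.tsum_mul_right]
  exact tsum_congr fun z' => by rw [show π z' = z from z'.2]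

theorem IsLift.mul (hA : IsLift π A' A) (hB : IsLift π B' B) : IsLift π (A' * B') (A * B) where
  nonneg' := hA.nonneg'.mul hB.nonneg'
  nonneg := hA.nonneg.mul hB.nonneg
  tsum_eq x y := by
    simp only [tsum_entry_mul hA.nonneg' hB, hA.tsum_eq, entry_mul hA.nonneg hB.nonneg]

theorem IsLift.pow_succ (hA : IsLift π A' A) (n : ℕ) : IsLift π (A' ^ (n + 1)) (A ^ (n + 1)) := by
  induction n with
  | zero => simpa using hA
  | succ n ih =>
    rw [_root_.pow_succ _ (n + 1), _root_.pow_succ _ (n + 1)]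
    exact ih.mul hA

theorem IsLift.sum_pow_succ (hA : IsLift π A' A) (n : ℕ) :
    IsLift π (∑ k ∈ Finset.range (n + 1), A' ^ (k + 1)) (∑ k ∈ Finset.range (n + 1), A ^ (k + 1)) := by
  induction n with
  | zero => simpa using hA
  | succ n ih =>
    rw [Finset.sum_range_succ _ (n + 1), Finset.sum_range_succ _ (n + 1)]
    exact ih.add (hA.pow_succ _)

theorem IsSublift.of_tendsto {ι : Type*} {l : Filter ι} [l.NeBot]
    {F' : ι → G'.ell2 →L[ℂ] G'.ell2} {F : ι → G.ell2 →L[ℂ] G.ell2}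
    (h' : Tendsto F' l (𝓝 A')) (h : Tendsto F l (𝓝 A)) (hF : ∀ᶠ i in l, IsLift π (F' i) (F i)) :
    IsSublift π A' A where
  nonneg' := .of_tendsto h' (hF.mono fun _ hi => hi.nonneg')
  nonneg := .of_tendsto h (hF.mono fun _ hi => hi.nonneg)
  tsum_le x y := by
    rw [ENNReal.tsum_eq_iSup_sum]
    refine iSup_le fun t => ?_
    refine le_of_tendsto_of_tendsto (tendsto_finsetSum t fun y' _ => tendsto_entry h' x y')
      (tendsto_entry h (π x) y) (hF.mono fun i hi => ?_)
    exact (ENNReal.sum_le_tsum t).trans (hi.tsum_eq x y).le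

/-- If `R = W + E R` upstairs and downstairs, `R` lifts with equality and both `W` and `E` lift with
an inequality, then no inequality can be strict, provided that the diagonal of `R` is positive. -/
theorem IsSublift.isLift_of_add_mul {E' W' R' : G'.ell2 →L[ℂ] G'.ell2} {E W R : G.ell2 →L[ℂ] G.ell2}
    (hE : IsSublift π E' E) (hW : IsSublift π W' W) (hR : IsLift π R' R)
    (h' : R' = W' + E' * R') (h : R = W + E * R) (hpos : ∀ y, entry R y y ≠ 0) :
    IsLift π E' E where
  nonneg' := hE.nonneg'
  nonneg := hE.nonneg
  tsum_eq x y := by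
    refine le_antisymm (hE.tsum_le x y) (not_lt.1 fun hlt => ?_)
    have e1 : entry R (π x) y
        = entry W (π x) y + ∑' z, entry E (π x) z * entry R z y := by
      conv_lhs => rw [h]
      rw [entry_add hW.nonneg (hE.nonneg.mul hR.nonneg), entry_mul hE.nonneg hR.nonneg]
    have e2 : entry R (π x) y = ∑' y' : π ⁻¹' {y}, entry W' x y'
        + ∑' z, (∑' z' : π ⁻¹' {z}, entry E' x z') * entry R z y := by
      rw [← tsum_entry_mul hE.nonneg' hR, ← ENNReal.tsum_add, ← hR.tsum_eq]
      refine tsum_congr fun y' => ?_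
      conv_lhs => rw [h']
      rw [entry_add hW.nonneg' (hE.nonneg'.mul hR.nonneg')]
    have hle : ∀ z, (∑' z' : π ⁻¹' {z}, entry E' x z') * entry R z y
        ≤ entry E (π x) z * entry R z y := fun z => mul_le_mul_left (hE.tsum_le x z) _
    have hfin : ∑' z, (∑' z' : π ⁻¹' {z}, entry E' x z') * entry R z y ≠ ⊤ := by
      refine ne_top_of_le_ne_top (entry_ne_top R (π x) y) ?_
      rw [e2]
      exact le_add_self
    have hstrict := ENNReal.tsum_lt_tsum hfin hle (i := y)
      ((ENNReal.mul_lt_mul_iff_left (hpos y) (entry_ne_top _ _ _)).2 hlt)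
    have := ENNReal.add_lt_add_of_le_of_lt (a := ∑' y' : π ⁻¹' {y}, entry W' x y')
      (ne_top_of_le_ne_top (entry_ne_top _ _ _) (hW.tsum_le x y)) (hW.tsum_le x y) hstrict
    rw [← e1, ← e2] at this
    exact lt_irrefl _ this

end Lifts

end WeightedGraph

/-! ### Solution operators on a regular covering -/

namespace WeightedGraph

section Coverings

variable {X X' : Type*} {G : WeightedGraph X} {G' : WeightedGraph X'} {π : X' → X}

theorem IsDeckTransformation.symm {γ : Equiv.Perm X'} (h : G'.IsDeckTransformation π γ) :
    G'.IsDeckTransformation π γ.symm where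
  proj x := by rw [← h.proj, Equiv.apply_symm_apply]
  weight x y := by rw [← h.weight, Equiv.apply_symm_apply, Equiv.apply_symm_apply]
  measure x := by rw [← h.measure, Equiv.apply_symm_apply]

/-- A deck transformation is a regular covering with one sheet. -/
theorem IsDeckTransformation.isRegularCovering {γ : Equiv.Perm X'}
    (h : G'.IsDeckTransformation π γ) : G'.IsRegularCovering G' γ where
  surjective := γ.surjective
  bijOn x := by
    refine ⟨fun y hy => ?_, γ.injective.injOn, fun y hy => ⟨γ.symm y, ?_, γ.apply_symm_apply y⟩⟩
    · change 0 < G'.b (γ x) (γ y)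
      rwa [h.weight]
    · change 0 < G'.b x (γ.symm y)
      rwa [← h.weight, γ.apply_symm_apply]
  weight x y _ := (h.weight x y).symm
  measure x := (h.measure x).symm
  regular x y hxy := ⟨Equiv.refl _, ⟨fun _ => rfl, fun _ _ => rfl, fun _ => rfl⟩, γ.injective hxy⟩

/-- The formal Laplacian commutes with the lift of functions along a covering. -/
theorem IsRegularCovering.realLaplacian_comp (hπ : G'.IsRegularCovering G π) (v : X → ℝ) (x : X') :
    G'.realLaplacian (fun y => v (π y)) x = G.realLaplacian v (π x) := by
  rw [realLaplacian, realLaplacian, hπ.measure]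
  congr 1
  have hmem' : ∀ y, y ∈ G'.nbhd x ↔ 0 < G'.b x y := fun y => by simp [nbhd]
  have hmem : ∀ y, y ∈ G.nbhd (π x) ↔ 0 < G.b (π x) y := fun y => by simp [nbhd]
  refine Finset.sum_nbij π (fun y hy => ?_) (fun y hy z hz => ?_) (fun y hy => ?_) fun y hy => ?_
  · exact (hmem _).2 ((hπ.bijOn x).mapsTo ((hmem' y).1 hy))
  · exact (hπ.bijOn x).injOn ((hmem' y).1 hy) ((hmem' z).1 hz)
  · obtain ⟨z, hz, rfl⟩ := (hπ.bijOn x).surjOn ((hmem y).1 hy)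
    exact ⟨z, (hmem' z).2 hz, rfl⟩
  · rw [hπ.weight x y ((hmem' y).1 hy)]

theorem realLaplacian_hasSum {ι : Type*} {q : ι → X → ℝ} {σ : X → ℝ}
    (h : ∀ x, HasSum (fun i => q i x) (σ x)) (x : X) :
    HasSum (fun i => G.realLaplacian (q i) x) (G.realLaplacian σ x) :=
  (hasSum_sum fun y _ => ((h x).sub (h y)).mul_left _).mul_left _

variable {a s : ℝ} {A : G.ell2 →L[ℂ] G.ell2} {A' : G'.ell2 →L[ℂ] G'.ell2}

theorem single_nonneg (x y : X) : 0 ≤ G.single y x := by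
  by_cases h : x = y
  · rw [h, single_apply_self]
    exact zero_le_one
  · rw [G.single_apply_of_ne h]

theorem hasNonnegEntries_of_isWeakSolution (ha : 0 < a) (hs : 0 < s)
    (hA : ∀ f, G.IsWeakSolution a s f (A f)) : HasNonnegEntries A := fun x y =>
  (hA _).nonneg ha hs (fun z => single_nonneg z y) x

theorem re_apply_single_eq (hA : ∀ f, G.IsWeakSolution a s f (A f)) (x y : X) :
    a * (A (G.single y) x).re + s * G.realLaplacian (fun z => (A (G.single y) z).re) x
      = (G.single y x).re := by
  have := congrArg Complex.re ((hA (G.single y)).pointwise x)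
  rwa [Complex.add_re, Complex.re_ofReal_mul, Complex.re_ofReal_mul, formalLaplacian_re] at this

theorem entry_self_ne_zero (ha : 0 < a) (hs : 0 < s) (hA : ∀ f, G.IsWeakSolution a s f (A f))
    (y : X) : entry A y y ≠ 0 := by
  have hnn := (hasNonnegEntries_of_isWeakSolution ha hs hA).re_nonneg
  rw [entry, ne_eq, ENNReal.ofReal_eq_zero, not_le]
  refine lt_of_le_of_ne (hnn y y) fun h0 => ?_
  have h1 := re_apply_single_eq hA y y
  have h2 : G.realLaplacian (fun z => (A (G.single y) z).re) y ≤ 0 := by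
    refine mul_nonpos_of_nonneg_of_nonpos (one_div_nonneg.2 (G.m_pos y).le)
      (Finset.sum_nonpos fun z _ => mul_nonpos_of_nonneg_of_nonpos (G.b_nonneg y z) ?_)
    simp only [← h0]
    linarith [hnn z y]
  rw [← h0, single_apply_self, Complex.one_re] at h1
  nlinarith

theorem re_apply_deck (ha : 0 < a) (hs : 0 < s) (hA' : ∀ f, G'.IsWeakSolution a s f (A' f))
    {γ : Equiv.Perm X'} (hγ : G'.IsDeckTransformation π γ) (x y : X') :
    (A' (G'.single (γ y)) (γ x)).re = (A' (G'.single y) x).re := by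
  have hle : ∀ {γ : Equiv.Perm X'}, G'.IsDeckTransformation π γ → ∀ x y,
      (A' (G'.single y) x).re ≤ (A' (G'.single (γ y)) (γ x)).re := by
    intro γ hγ x y
    refine (hA' (G'.single y)).re_le ha hs
      (v := fun x => (A' (G'.single (γ y)) (γ x)).re)
      (fun x => (hasNonnegEntries_of_isWeakSolution ha hs hA').re_nonneg _ _) (fun x => ?_) x
    rw [hγ.isRegularCovering.realLaplacian_comp fun x => (A' (G'.single (γ y)) x).re,
      re_apply_single_eq hA']
    by_cases h : x = y
    · rw [h, single_apply_self, single_apply_self]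
    · rw [G'.single_apply_of_ne h, G'.single_apply_of_ne (γ.injective.ne h)]
  refine le_antisymm ?_ (hle hγ x y)
  simpa using hle hγ.symm (γ x) (γ y)

/-- Solution operators of `a u + s L u = f` lift along regular coverings. The lift of the solution
downstairs is a supersolution upstairs, which bounds the sums over the fiber. These sums are
invariant under deck transformations, hence descend to a nonnegative solution downstairs, which by
minimality cannot be smaller. -/
theorem IsRegularCovering.isLift_of_isWeakSolution (hπ : G'.IsRegularCovering G π)
    (ha : 0 < a) (hs : 0 < s) (hA' : ∀ f, G'.IsWeakSolution a s f (A' f))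
    (hA : ∀ f, G.IsWeakSolution a s f (A f)) : IsLift π A' A := by
  classical
  have hn' := hasNonnegEntries_of_isWeakSolution ha hs hA'
  have hn := hasNonnegEntries_of_isWeakSolution ha hs hA
  refine ⟨hn', hn, fun x y => ?_⟩
  have hfin : ∀ (t : Finset (π ⁻¹' {y})) x,
      ∑ y' ∈ t, (A' (G'.single y') x).re ≤ (A (G.single y) (π x)).re := by
    intro t x
    have h := (IsWeakSolution.sum t (f := fun y' => G'.single (y' : X')) fun y' _ => hA' _).re_le
      ha hs (v := fun x => (A (G.single y) (π x)).re) (fun x => hn.re_nonneg _ _) (fun x => ?_) x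
    · rwa [ell2_sum_apply, Complex.re_sum] at h
    · rw [hπ.realLaplacian_comp fun x => (A (G.single y) x).re, re_apply_single_eq hA,
        ell2_sum_apply, Complex.re_sum]
      by_cases hx : π x = y
      · rw [hx, single_apply_self, Complex.one_re]
        refine (Finset.sum_le_sum_of_subset_of_nonneg (Finset.subset_insert ⟨x, hx⟩ t)
          fun y' _ _ => (Complex.le_def.1 (single_nonneg x (y' : X'))).1).trans ?_
        rw [Finset.sum_eq_single_of_mem (⟨x, hx⟩ : π ⁻¹' {y}) (Finset.mem_insert_self _ _)]
        · rw [single_apply_self, Complex.one_re]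
        · intro y' _ hy'
          rw [G'.single_apply_of_ne fun h => hy' (Subtype.ext h.symm), Complex.zero_re]
      · rw [G.single_apply_of_ne hx, Complex.zero_re]
        refine Finset.sum_nonpos fun y' _ => ?_
        rw [G'.single_apply_of_ne fun h => hx (by rw [h]; exact y'.2), Complex.zero_re]
  have hsum : ∀ x, Summable fun y' : π ⁻¹' {y} => (A' (G'.single y') x).re := fun x =>
    summable_of_sum_le (fun y' => hn'.re_nonneg _ _) fun t => hfin t x
  set σ : X' → ℝ := fun x => ∑' y' : π ⁻¹' {y}, (A' (G'.single y') x).re with hσ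
  have hσ_le : ∀ x, σ x ≤ (A (G.single y) (π x)).re := fun x =>
    (hsum x).tsum_le_of_sum_le fun t => hfin t x
  have hσ_nonneg : ∀ x, 0 ≤ σ x := fun x => tsum_nonneg fun y' => hn'.re_nonneg _ _
  have hσ_eq : ∀ x, a * σ x + s * G'.realLaplacian σ x = (G.single y (π x)).re := by
    intro x
    have h1 := ((hsum x).hasSum.mul_left a).add
      ((realLaplacian_hasSum (G := G') (fun x => (hsum x).hasSum) x).mul_left s)
    simp only [re_apply_single_eq hA'] at h1
    refine h1.unique ?_
    by_cases hx : π x = y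
    · rw [hx, single_apply_self]
      convert! hasSum_single (⟨x, hx⟩ : π ⁻¹' {y}) fun y' hy' => ?_
      · rw [single_apply_self]
      · rw [G'.single_apply_of_ne fun h => hy' (Subtype.ext h.symm), Complex.zero_re]
    · rw [G.single_apply_of_ne hx]
      convert! hasSum_zero with y'
      rw [G'.single_apply_of_ne fun h => hx (by rw [h]; exact y'.2), Complex.zero_re]
  have hσ_deck : ∀ {γ : Equiv.Perm X'}, G'.IsDeckTransformation π γ → ∀ x, σ (γ x) = σ x := by
    intro γ hγ x
    let e : π ⁻¹' {y} ≃ π ⁻¹' {y} := γ.subtypeEquiv fun z => by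
      change π z = y ↔ π (γ z) = y
      rw [hγ.proj]
    rw [hσ]
    simp only
    rw [← e.tsum_eq]
    exact tsum_congr fun y' => re_apply_deck ha hs hA' hγ x y'
  set v : X → ℝ := fun x => σ (Function.surjInv hπ.surjective x) with hv
  have hσv : ∀ x, σ x = v (π x) := by
    intro x
    obtain ⟨γ, hγ, hx⟩ := hπ.regular x (Function.surjInv hπ.surjective (π x))
      (Function.surjInv_eq hπ.surjective _).symm
    rw [hv]
    simp only
    rw [← hx, hσ_deck hγ]
  have hle : (A (G.single y) (π x)).re ≤ σ x := by
    rw [hσv]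
    refine (hA (G.single y)).re_le ha hs (fun _ => hσ_nonneg _) (fun z => ?_) (π x)
    obtain ⟨z, rfl⟩ := hπ.surjective z
    change _ ≤ a * v (π z) + s * G.realLaplacian v (π z)
    rw [← hπ.realLaplacian_comp, ← hσv, ← hσ_eq, ← funext hσv]
  rw [entry, le_antisymm hle (hσ_le x), hσ,
    ENNReal.ofReal_tsum_of_nonneg (fun y' => hn'.re_nonneg _ _) (hsum x)]
  rfl

end Coverings

end WeightedGraph

/-! ### Backward Euler approximation of the heat semigroup -/

/-- Backward Euler steps approximate the exponential uniformly on `[0, ∞)`. The number of steps is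
taken even so that Bernoulli's inequality gives a quadratic lower bound for `(1 + x) ^ (2 * M)`. -/
theorem Real.abs_inv_one_add_pow_sub_exp_le {a : ℝ} (ha : 0 ≤ a) {M : ℕ} (hM : 0 < M) :
    |((1 + a / (2 * M : ℕ)) ^ (2 * M))⁻¹ - Real.exp (-a)| ≤ 2 / M := by
  have hM' : (0 : ℝ) < M := by exact_mod_cast hM
  set N := 2 * M with hN
  have hN' : (0 : ℝ) < N := by rw [hN]; push_cast; positivity
  set x := a / N with hx
  have hx0 : 0 ≤ x := by positivity
  have hexp : Real.exp (-a) = Real.exp (-x) ^ N := by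
    rw [← Real.exp_nat_mul, hx]
    congr 1
    field_simp
  have hP : 0 < (1 + x) ^ N := by positivity
  have hupper : Real.exp (-a) ≤ ((1 + x) ^ N)⁻¹ := by
    rw [hexp, ← inv_pow, Real.exp_neg]
    gcongr
    linarith [Real.add_one_le_exp x]
  -- From `1 - x ≤ e⁻ˣ`, the steps satisfy `(1 - x²) / (1 + x) ≤ e⁻ˣ`; Bernoulli's inequality turns
  -- this into a bound for the powers, which is trivial once `N x² > 1`.
  have hlower : (1 - N * x ^ 2) * ((1 + x) ^ N)⁻¹ ≤ Real.exp (-a) := by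
    rcases le_or_gt (N * x ^ 2) 1 with h | h
    · have h1N : (1 : ℝ) ≤ N := by exact_mod_cast (by omega : 1 ≤ N)
      have hx1 : x ^ 2 ≤ 1 := by nlinarith [sq_nonneg x]
      have h1 : 1 - N * x ^ 2 ≤ (1 - x ^ 2) ^ N := by
        have := one_add_mul_le_pow (a := -x ^ 2) (by linarith) N
        rw [← sub_eq_add_neg] at this
        linarith
      have h2 : 1 - x ^ 2 ≤ Real.exp (-x) * (1 + x) := by
        nlinarith [Real.add_one_le_exp (-x)]
      rw [hexp, ← div_eq_mul_inv, div_le_iff₀ hP, ← mul_pow]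
      exact h1.trans (pow_le_pow_left₀ (by linarith) h2 N)
    · exact (mul_nonpos_of_nonpos_of_nonneg (by linarith) (by positivity)).trans (Real.exp_pos _).le
  have hsq : (M * x) ^ 2 ≤ (1 + x) ^ N := by
    rw [hN, mul_comm 2 M, pow_mul]
    refine pow_le_pow_left₀ (by positivity) ?_ 2
    linarith [one_add_mul_le_pow (a := x) (by linarith) M]
  have hsmall : N * x ^ 2 * ((1 + x) ^ N)⁻¹ ≤ 2 / M := by
    rw [← div_eq_mul_inv, div_le_div_iff₀ hP hM']
    calc N * x ^ 2 * M = 2 * (M * x) ^ 2 := by rw [hN]; push_cast; ring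
      _ ≤ 2 * (1 + x) ^ N := by linarith
  rw [abs_of_nonneg (by linarith)]
  linarith

namespace WeightedGraph

variable {X : Type*} (G : WeightedGraph X)

theorem isSelfAdjoint_resolvent : IsSelfAdjoint G.resolvent :=
  .of_nonneg G.resolvent_nonneg

theorem nonneg_of_mem_spectrum {r : ℝ} (hr : r ∈ spectrum ℝ G.resolvent) : 0 ≤ r :=
  spectrum_nonneg_of_nonneg G.resolvent_nonneg hr

theorem isWeakSolution_resolvent (f : G.ell2) : G.IsWeakSolution 1 1 f (G.resolvent f) where
  mem := (G.resolvent_weak f).1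
  eq φ := by
    rw [Complex.ofReal_one, one_smul, one_mul]
    exact (G.resolvent_weak f).2 φ

/-- The backward Euler step `(1 + s (L + 1))⁻¹`, expressed through `R = (L + 1)⁻¹` as
`R (R + s)⁻¹`. -/
def eulerStep (s : ℝ) : G.ell2 →L[ℂ] G.ell2 :=
  cfc (fun r : ℝ => r / (r + s)) G.resolvent

theorem continuousOn_eulerStep {s : ℝ} (hs : 0 < s) :
    ContinuousOn (fun r : ℝ => r / (r + s)) (spectrum ℝ G.resolvent) :=
  continuousOn_id.div (continuousOn_id.add continuousOn_const) fun r hr => by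
    exact (add_pos_of_nonneg_of_pos (G.nonneg_of_mem_spectrum hr) hs).ne'

theorem resolvent_eq_mul_add {s : ℝ} (hs : 0 < s) :
    G.resolvent = G.resolvent * G.eulerStep s + (s : ℂ) • G.eulerStep s := by
  have hc := G.continuousOn_eulerStep hs
  have hR := G.isSelfAdjoint_resolvent
  have h1 : cfc (fun r : ℝ => r * (r / (r + s)) + s * (r / (r + s))) G.resolvent
      = G.resolvent := by
    conv_rhs => rw [← cfc_id ℝ G.resolvent]
    refine cfc_congr fun r hr => ?_
    have := G.nonneg_of_mem_spectrum hr
    have hne : r + s ≠ 0 := by linarith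
    simp only [id]
    field_simp
  rw [cfc_add (a := G.resolvent) (fun r : ℝ => r * (r / (r + s))) (fun r : ℝ => s * (r / (r + s)))
      (continuousOn_id.mul hc) (continuousOn_const.mul hc),
    cfc_mul (fun r : ℝ => r) (fun r : ℝ => r / (r + s)) G.resolvent continuousOn_id hc,
    cfc_const_mul s (fun r : ℝ => r / (r + s)) G.resolvent hc, cfc_id' ℝ G.resolvent] at h1
  conv_lhs => rw [← h1]
  rfl

theorem commute_eulerStep (s : ℝ) : G.resolvent * G.eulerStep s = G.eulerStep s * G.resolvent :=
  ((Commute.refl G.resolvent).cfc_real _).eq.symm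

theorem isWeakSolution_eulerStep {s : ℝ} (hs : 0 < s) (f : G.ell2) :
    G.IsWeakSolution (1 + s) s f (G.eulerStep s f) := by
  have h : G.resolvent (f - G.eulerStep s f) = (s : ℂ) • G.eulerStep s f := by
    rw [map_sub, sub_eq_iff_eq_add']
    exact congrArg (fun T : G.ell2 →L[ℂ] G.ell2 => T f) (G.resolvent_eq_mul_add hs)
  obtain ⟨h1, h2⟩ := G.resolvent_weak (f - G.eulerStep s f)
  rw [h] at h1 h2
  have hs' : (s : ℂ) ≠ 0 := by exact_mod_cast hs.ne'
  refine ⟨(Submodule.smul_mem_iff _ hs').1 h1, fun φ => ?_⟩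
  have h3 := h2 φ
  rw [inner_smul_left, Complex.conj_ofReal] at h3
  rw [← h3]
  congr 1
  push_cast
  rw [add_smul, one_smul]
  abel

theorem resolvent_sub_pow_mul {s : ℝ} (hs : 0 < s) (N : ℕ) :
    G.resolvent - G.eulerStep s ^ N * G.resolvent
      = (s : ℂ) • ∑ k ∈ Finset.range N, G.eulerStep s ^ (k + 1) := by
  induction N with
  | zero => simp
  | succ N ih =>
    rw [Finset.sum_range_succ, smul_add, ← ih]
    have h := G.resolvent_eq_mul_add hs
    rw [commute_eulerStep] at h
    have h2 : (s : ℂ) • G.eulerStep s ^ (N + 1)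
        = G.eulerStep s ^ N * (G.resolvent - G.eulerStep s * G.resolvent) := by
      rw [sub_eq_iff_eq_add'.2 h, mul_smul_comm, pow_succ]
    rw [h2, mul_sub, ← mul_assoc, ← pow_succ]
    abel

/-- The function `r ↦ exp (-t / r)` on `[0, ∞)`, with value `0` at `0`. On `r = 1 / (λ + 1)` it is
`exp (-t (λ + 1))`. -/
def expNegDiv (t r : ℝ) : ℝ := if 0 < r then Real.exp (-(t / r)) else 0

theorem tendstoUniformlyOn_expNegDiv {t : ℝ} (ht : 0 < t) :
    TendstoUniformlyOn (fun (n : ℕ) (r : ℝ) =>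
      (r / (r + t / (2 * (n + 1) : ℕ))) ^ (2 * (n + 1))) (expNegDiv t) atTop (Set.Ici 0) := by
  rw [Metric.tendstoUniformlyOn_iff]
  intro ε hε
  have hlim : Tendsto (fun n : ℕ => 2 / (((n + 1 : ℕ) : ℝ))) atTop (𝓝 0) :=
    (tendsto_const_div_atTop_nhds_zero_nat 2).comp (tendsto_add_atTop_nat 1)
  filter_upwards [hlim.eventually (gt_mem_nhds hε)] with n hn r hr
  rw [dist_comm, Real.dist_eq]
  rcases (show (0 : ℝ) ≤ r from hr).eq_or_lt with rfl | hr0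
  · simpa [expNegDiv] using hε
  · refine lt_of_le_of_lt ?_ hn
    have h := Real.abs_inv_one_add_pow_sub_exp_le (div_nonneg ht.le hr0.le) n.succ_pos
    have hpow : (r / (r + t / (2 * (n + 1) : ℕ))) ^ (2 * (n + 1))
        = ((1 + t / r / (2 * (n + 1) : ℕ)) ^ (2 * (n + 1)))⁻¹ := by
      rw [← inv_pow]
      congr 1
      have hpos : (0 : ℝ) < (2 * (n + 1) : ℕ) := by positivity
      field_simp
    rw [expNegDiv, if_pos hr0, hpow]
    exact h

theorem tendstoUniformlyOn_spectrum {t : ℝ} (ht : 0 < t) :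
    TendstoUniformlyOn (fun (n : ℕ) (r : ℝ) =>
      (r / (r + t / (2 * (n + 1) : ℕ))) ^ (2 * (n + 1))) (expNegDiv t) atTop
      (spectrum ℝ G.resolvent) :=
  (tendstoUniformlyOn_expNegDiv ht).mono fun _ hr => G.nonneg_of_mem_spectrum hr

theorem step_pos {t : ℝ} (ht : 0 < t) (n : ℕ) : 0 < t / (2 * (n + 1) : ℕ) := by positivity

theorem continuousOn_expNegDiv {t : ℝ} (ht : 0 < t) :
    ContinuousOn (expNegDiv t) (spectrum ℝ G.resolvent) :=
  (G.tendstoUniformlyOn_spectrum ht).continuousOn (Frequently.of_forall fun n =>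
    (G.continuousOn_eulerStep (step_pos ht n)).pow _)

/-- Backward Euler approximation of `e^{-t (L + 1)}`. -/
theorem tendsto_eulerStep_pow {t : ℝ} (ht : 0 < t) :
    Tendsto (fun n : ℕ => G.eulerStep (t / (2 * (n + 1) : ℕ)) ^ (2 * (n + 1))) atTop
      (𝓝 (cfc (expNegDiv t) G.resolvent)) := by
  have h := tendsto_cfc_fun (G.tendstoUniformlyOn_spectrum ht) (Eventually.of_forall fun n =>
    (G.continuousOn_eulerStep (step_pos ht n)).pow _)
  refine h.congr fun n => ?_
  exact cfc_pow _ _ _ (G.continuousOn_eulerStep (step_pos ht n)) G.isSelfAdjoint_resolvent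

theorem heatSemigroup_eq_smul {t : ℝ} (ht : 0 < t) :
    G.heatSemigroup t = (Real.exp t : ℂ) • cfc (expNegDiv t) G.resolvent := by
  have h : G.heatSemigroup t = cfc (fun r => Real.exp t * expNegDiv t r) G.resolvent := by
    refine cfc_congr fun r _ => ?_
    simp only [expNegDiv]
    split_ifs with hr
    · rw [← Real.exp_add]
      congr 1
      ring
    · rw [mul_zero]
  rw [h, cfc_const_mul _ _ _ (G.continuousOn_expNegDiv ht)]
  rfl

theorem heatSemigroup_nonneg (t : ℝ) : 0 ≤ G.heatSemigroup t := by
  refine cfc_nonneg fun r _ => ?_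
  split_ifs
  · exact (Real.exp_pos _).le
  · exact le_rfl

variable {G} {X' : Type*} {G' : WeightedGraph X'} {π : X' → X}

/-- The heat semigroup lifts along regular coverings. Passing to the limit in the backward Euler
scheme only gives an inequality, both for `E = e^{-t (L + 1)}` and for
`R - E R = ∫_0^t e^{-s (L + 1)} ds`; since `R` itself lifts, both must be equalities. -/
theorem IsRegularCovering.isLift_heatSemigroup (hπ : G'.IsRegularCovering G π) {t : ℝ}
    (ht : 0 < t) : IsLift π (G'.heatSemigroup t) (G.heatSemigroup t) := by
  rw [heatSemigroup_eq_smul _ ht, heatSemigroup_eq_smul _ ht]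
  refine IsLift.smul ?_ (Real.exp_pos t).le
  have hQ : ∀ n : ℕ, IsLift π (G'.eulerStep (t / (2 * (n + 1) : ℕ)))
      (G.eulerStep (t / (2 * (n + 1) : ℕ))) := fun n =>
    hπ.isLift_of_isWeakSolution (by linarith [step_pos ht n]) (step_pos ht n)
      (G'.isWeakSolution_eulerStep (step_pos ht n)) (G.isWeakSolution_eulerStep (step_pos ht n))
  have hR : IsLift π G'.resolvent G.resolvent := hπ.isLift_of_isWeakSolution one_pos one_pos
    G'.isWeakSolution_resolvent G.isWeakSolution_resolvent
  have hE := IsSublift.of_tendsto (G'.tendsto_eulerStep_pow ht) (G.tendsto_eulerStep_pow ht)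
    (Eventually.of_forall fun n => (hQ n).pow_succ (2 * n + 1))
  have hW := IsSublift.of_tendsto (π := π)
    (((G'.tendsto_eulerStep_pow ht).mul_const G'.resolvent).const_sub G'.resolvent)
    (((G.tendsto_eulerStep_pow ht).mul_const G.resolvent).const_sub G.resolvent)
    (Eventually.of_forall fun n => by
      rw [resolvent_sub_pow_mul _ (step_pos ht n), resolvent_sub_pow_mul _ (step_pos ht n)]
      exact ((hQ n).sum_pow_succ (2 * n + 1)).smul (step_pos ht n).le)
  exact hE.isLift_of_add_mul hW hR (sub_add_cancel _ _).symm (sub_add_cancel _ _).symm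
    (entry_self_ne_zero one_pos one_pos G.isWeakSolution_resolvent)

end WeightedGraph

/-! ### Heat kernel and Green's function of a covering -/

namespace WeightedGraph

variable {X X' : Type*} {G : WeightedGraph X} {G' : WeightedGraph X'} {π : X' → X}

theorem IsDeckTransformation.isLift_heatSemigroup {γ : Equiv.Perm X'}
    (hγ : G'.IsDeckTransformation π γ) {t : ℝ} (ht : 0 < t) :
    IsLift γ (G'.heatSemigroup t) (G'.heatSemigroup t) :=
  hγ.isRegularCovering.isLift_heatSemigroup ht

theorem ofReal_heatKernel_mul (t : ℝ) (x y : X) :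
    ENNReal.ofReal (G.heatKernel t x y * G.m y) = entry (G.heatSemigroup t) x y := by
  rw [heatKernel, div_mul_cancel₀ _ (G.m_pos y).ne', entry]

theorem ofReal_heatKernel (t : ℝ) (x y : X) :
    ENNReal.ofReal (G.heatKernel t x y)
      = entry (G.heatSemigroup t) x y * ENNReal.ofReal (G.m y)⁻¹ := by
  rw [heatKernel, div_eq_mul_inv, ENNReal.ofReal_mul' (inv_nonneg.2 (G.m_pos y).le)]
  rfl

/-- The heat kernel of the base is the heat kernel of the covering summed over a fiber. -/
theorem IsRegularCovering.tsum_heatKernel (hπ : G'.IsRegularCovering G π) {t : ℝ} (ht : 0 < t)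
    (x : X') (y : X) :
    ∑' y' : π ⁻¹' {y}, ENNReal.ofReal (G'.heatKernel t x y')
      = ENNReal.ofReal (G.heatKernel t (π x) y) := by
  rw [ofReal_heatKernel, ← (hπ.isLift_heatSemigroup ht).tsum_eq, ← ENNReal.tsum_mul_right]
  refine tsum_congr fun y' => ?_
  rw [ofReal_heatKernel, hπ.measure, show π y' = y from y'.2]

theorem IsRegularCovering.totalHeat_eq (hπ : G'.IsRegularCovering G π) {t : ℝ} (ht : 0 < t)
    (x : X') : G'.totalHeat t x = G.totalHeat t (π x) := by
  simp only [totalHeat, ofReal_heatKernel_mul]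
  rw [← ENNReal.tsum_fiberwise _ π]
  exact tsum_congr fun y => (hπ.isLift_heatSemigroup ht).tsum_eq x y

theorem IsRegularCovering.heatKernel_nonneg (hπ : G'.IsRegularCovering G π) {t : ℝ} (ht : 0 < t)
    (x y : X) : 0 ≤ G.heatKernel t x y :=
  div_nonneg ((hπ.isLift_heatSemigroup ht).nonneg.re_nonneg x y) (G.m_pos y).le

theorem IsRegularCovering.heatKernel_nonneg' (hπ : G'.IsRegularCovering G π) {t : ℝ} (ht : 0 < t)
    (x y : X') : 0 ≤ G'.heatKernel t x y :=
  div_nonneg ((hπ.isLift_heatSemigroup ht).nonneg'.re_nonneg x y) (G'.m_pos y).le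

theorem IsRegularCovering.ofReal_heatKernel_le (hπ : G'.IsRegularCovering G π) {t : ℝ} (ht : 0 < t)
    (x y : X') :
    ENNReal.ofReal (G'.heatKernel t x y) ≤ ENNReal.ofReal (G.heatKernel t (π x) (π y)) := by
  rw [← hπ.tsum_heatKernel ht]
  exact ENNReal.le_tsum (f := fun y' : π ⁻¹' {π y} => ENNReal.ofReal (G'.heatKernel t x y'))
    ⟨y, rfl⟩

/-- For a nonnegative function, vanishing at infinity means that all superlevel sets are finite. -/
theorem tendsto_cofinite_zero_iff {ι : Type*} {f : ι → ℝ} (hf : ∀ i, 0 ≤ f i) :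
    Tendsto f cofinite (𝓝 0) ↔ ∀ ε > 0, {i | ε ≤ f i}.Finite := by
  rw [Metric.tendsto_nhds]
  refine forall₂_congr fun ε _ => ?_
  rw [eventually_cofinite]
  simp only [dist_zero_right, Real.norm_eq_abs, abs_of_nonneg (hf _), not_lt]

theorem IsRegularCovering.tendsto_heatKernel (hπ : G'.IsRegularCovering G π) {t : ℝ} (ht : 0 < t)
    {x : X'} (h : Tendsto (fun y => G.heatKernel t (π x) y) cofinite (𝓝 0)) :
    Tendsto (fun y => G'.heatKernel t x y) cofinite (𝓝 0) := by
  rw [tendsto_cofinite_zero_iff (hπ.heatKernel_nonneg ht _)] at h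
  rw [tendsto_cofinite_zero_iff (hπ.heatKernel_nonneg' ht _)]
  intro ε hε
  -- Only finitely many fibers matter, and over each of them the kernel is summable.
  have hfib : ∀ y, {y' : π ⁻¹' {y} | ENNReal.ofReal ε
      ≤ ENNReal.ofReal (G'.heatKernel t x y')}.Finite := fun y =>
    ENNReal.finite_const_le_of_tsum_ne_top
      (by rw [hπ.tsum_heatKernel ht]; exact ENNReal.ofReal_ne_top) (ENNReal.ofReal_pos.2 hε).ne'
  refine ((h ε hε).biUnion fun y _ => (hfib y).image Subtype.val).subset fun y' hy' => ?_
  have hy : ε ≤ G'.heatKernel t x y' := hy'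
  refine Set.mem_biUnion (x := π y') ?_ ⟨⟨y', rfl⟩, ENNReal.ofReal_le_ofReal hy, rfl⟩
  exact (ENNReal.ofReal_le_ofReal_iff (hπ.heatKernel_nonneg ht _ _)).1
    ((ENNReal.ofReal_le_ofReal hy).trans (hπ.ofReal_heatKernel_le ht x y'))

/-- Along an edge of the base, unique path lifting injects one fiber into the other. -/
theorem IsRegularCovering.card_fiber_le (hπ : G'.IsRegularCovering G π)
    (hfin : ∀ x, (π ⁻¹' {x}).Finite) {u v : X} (huv : 0 < G.b u v) :
    Nat.card (π ⁻¹' {u}) ≤ Nat.card (π ⁻¹' {v}) := by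
  have : ∀ z : π ⁻¹' {u}, ∃ w : π ⁻¹' {v}, 0 < G'.b z w := by
    rintro ⟨z, rfl⟩
    obtain ⟨w, hw, rfl⟩ := (hπ.bijOn z).surjOn huv
    exact ⟨⟨w, rfl⟩, hw⟩
  choose f hf using this
  have := (hfin v).to_subtype
  refine Nat.card_le_card_of_injective f fun z₁ z₂ h => Subtype.ext ?_
  refine (hπ.bijOn (f z₁)).injOn ?_ ?_ (z₁.2.trans z₂.2.symm)
  · change 0 < G'.b _ _
    rw [G'.b_symm]
    exact hf z₁
  · change 0 < G'.b _ _
    rw [G'.b_symm, h]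
    exact hf z₂

theorem IsRegularCovering.exists_card_fiber_le (hπ : G'.IsRegularCovering G π)
    (hfin : ∀ x, (π ⁻¹' {x}).Finite) : ∃ n : ℕ, 0 < n ∧ ∀ y, Nat.card (π ⁻¹' {y}) ≤ n := by
  rcases isEmpty_or_nonempty X with hX | ⟨⟨x⟩⟩
  · exact ⟨1, one_pos, fun y => hX.elim y⟩
  · refine ⟨Nat.card (π ⁻¹' {x}) + 1, Nat.succ_pos _, fun y => Nat.le_succ_of_le ?_⟩
    induction G.connected y x using Relation.ReflTransGen.head_induction_on with
    | refl => exact le_rfl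
    | head h _ ih => exact (hπ.card_fiber_le hfin h).trans ih

/-- A fiber sum over at most `n` points is at most `n` times a bound for its terms. -/
theorem IsRegularCovering.heatKernel_le_mul (hπ : G'.IsRegularCovering G π)
    (hfin : ∀ x, (π ⁻¹' {x}).Finite) {n : ℕ} (hn : ∀ y, Nat.card (π ⁻¹' {y}) ≤ n) {t : ℝ}
    (ht : 0 < t) {x : X'} {y : X} {c : ℝ≥0∞}
    (hc : ∀ y', π y' = y → ENNReal.ofReal (G'.heatKernel t x y') ≤ c) :
    ENNReal.ofReal (G.heatKernel t (π x) y) ≤ n * c := by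
  have := (hfin y).fintype
  rw [← hπ.tsum_heatKernel ht, tsum_fintype]
  refine (Finset.sum_le_card_nsmul _ (fun y' : π ⁻¹' {y} => ENNReal.ofReal (G'.heatKernel t x y')) c
    fun y' _ => hc y' y'.2).trans ?_
  rw [nsmul_eq_mul, Finset.card_univ, ← Nat.card_eq_fintype_card]
  gcongr
  exact hn y

theorem IsRegularCovering.tendsto_heatKernel_of_finite (hπ : G'.IsRegularCovering G π)
    (hfin : ∀ x, (π ⁻¹' {x}).Finite) {t : ℝ} (ht : 0 < t) {x : X'}
    (h : Tendsto (fun y => G'.heatKernel t x y) cofinite (𝓝 0)) :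
    Tendsto (fun y => G.heatKernel t (π x) y) cofinite (𝓝 0) := by
  obtain ⟨n, hn0, hn⟩ := hπ.exists_card_fiber_le hfin
  have hn0' : (0 : ℝ) < n := by exact_mod_cast hn0
  rw [tendsto_cofinite_zero_iff (hπ.heatKernel_nonneg' ht _)] at h
  rw [tendsto_cofinite_zero_iff (hπ.heatKernel_nonneg ht _)]
  intro ε hε
  refine ((h (ε / (2 * n)) (by positivity)).image π).subset fun y hy => ?_
  by_contra hcon
  have hlt : ∀ y', π y' = y →
      ENNReal.ofReal (G'.heatKernel t x y') ≤ ENNReal.ofReal (ε / (2 * n)) := fun y' hy' =>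
    ENNReal.ofReal_le_ofReal (le_of_not_ge fun hle => hcon ⟨y', hle, hy'⟩)
  have h1 := hπ.heatKernel_le_mul hfin hn ht hlt
  rw [← ENNReal.ofReal_natCast, ← ENNReal.ofReal_mul hn0'.le,
    ENNReal.ofReal_le_ofReal_iff (by positivity)] at h1
  have h2 : (n : ℝ) * (ε / (2 * n)) = ε / 2 := by field_simp
  have h3 : ε ≤ G.heatKernel t (π x) y := hy
  linarith

/-- For a positive operator, an entry between two vertices with equal diagonal entries is at most
the diagonal entry. -/
theorem re_apply_single_le {T : G.ell2 →L[ℂ] G.ell2} (hT : 0 ≤ T) {x y : X} (hm : G.m y = G.m x)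
    (hd : (T (G.single y) y).re = (T (G.single x) x).re) :
    (T (G.single y) x).re ≤ (T (G.single x) x).re := by
  have hpos : T.IsPositive := (ContinuousLinearMap.nonneg_iff_isPositive T).1 hT
  have h1 : 0 ≤ (⟪G.single x - G.single y, T (G.single x - G.single y)⟫_ℂ).re :=
    hpos.re_inner_nonneg_right _
  have h2 : G.m x * (T (G.single y) x).re = G.m y * (T (G.single x) y).re := by
    have := congrArg Complex.re (hpos.isSymmetric (G.single x) (G.single y))
    change (⟪T (G.single x), G.single y⟫_ℂ).re = (⟪G.single x, T (G.single y)⟫_ℂ).re at this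
    rw [inner_single, single_inner, Complex.re_ofReal_mul, Complex.re_ofReal_mul,
      Complex.conj_re] at this
    exact this.symm
  rw [map_sub, inner_sub_left, single_inner, single_inner, ell2_sub_apply, ell2_sub_apply,
    Complex.sub_re, Complex.re_ofReal_mul, Complex.re_ofReal_mul, Complex.sub_re, Complex.sub_re,
    hd, hm] at h1
  rw [hm] at h2
  have h3 := mul_left_cancel₀ (G.m_pos x).ne' h2
  rw [← h3] at h1
  have h4 : 0 ≤ G.m x * (2 * ((T (G.single x) x).re - (T (G.single y) x).re)) := by linarith
  have h5 := nonneg_of_mul_nonneg_right h4 (G.m_pos x)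
  linarith

theorem IsRegularCovering.heatKernel_le_diag (hπ : G'.IsRegularCovering G π) {t : ℝ} (ht : 0 < t)
    {x y : X'} (hxy : π x = π y) : G'.heatKernel t x y ≤ G'.heatKernel t x x := by
  obtain ⟨γ, hγ, rfl⟩ := hπ.regular x y hxy
  rw [heatKernel, heatKernel, hγ.measure]
  refine div_le_div_of_nonneg_right ?_ (G'.m_pos x).le
  refine re_apply_single_le (G'.heatSemigroup_nonneg t) (hγ.measure x) ?_
  have hl := hγ.isLift_heatSemigroup ht
  have h := hl.tsum_eq x (γ x)
  rw [tsum_eq_single (⟨x, rfl⟩ : γ ⁻¹' {γ x}) fun y hy =>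
    absurd (Subtype.ext (γ.injective (show γ y = γ x from y.2))) hy] at h
  exact ((ENNReal.ofReal_eq_ofReal_iff (hl.nonneg.re_nonneg _ _) (hl.nonneg.re_nonneg _ _)).1
    h).symm

theorem IsRegularCovering.green_le (hπ : G'.IsRegularCovering G π) (x : X') :
    G'.green x x ≤ G.green (π x) (π x) :=
  setLIntegral_mono' measurableSet_Ioi fun _ ht => hπ.ofReal_heatKernel_le ht x x

theorem IsRegularCovering.green_le_mul (hπ : G'.IsRegularCovering G π)
    (hfin : ∀ x, (π ⁻¹' {x}).Finite) {n : ℕ} (hn : ∀ y, Nat.card (π ⁻¹' {y}) ≤ n) (x : X') :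
    G.green (π x) (π x) ≤ n * G'.green x x := by
  rw [green, green, ← lintegral_const_mul' _ _ (ENNReal.natCast_ne_top n)]
  exact setLIntegral_mono' measurableSet_Ioi fun t ht => hπ.heatKernel_le_mul hfin hn ht
    fun y' hy' => ENNReal.ofReal_le_ofReal (hπ.heatKernel_le_diag ht hy'.symm)

end WeightedGraph

end

theorem theorem4p5 {X X' : Type*} [Countable X] [Countable X']
    (G : WeightedGraph X) (G' : WeightedGraph X') (π : X' → X)
    (hπ : G'.IsRegularCovering G π) :
    ((G'.StochasticallyIncompleteSome ↔ G.StochasticallyIncompleteSome) ∧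
      (G'.StochasticallyIncompleteAll ↔ G.StochasticallyIncompleteAll)) ∧
    ((G.FellerSome → G'.FellerSome) ∧ (G.FellerAll → G'.FellerAll)) ∧
    (G.UniformlyTransient → G'.UniformlyTransient) ∧
    ((∀ x, (π ⁻¹' {x}).Finite) →
      ((G.FellerSome ↔ G'.FellerSome) ∧ (G.FellerAll ↔ G'.FellerAll)) ∧
      (G.UniformlyTransient ↔ G'.UniformlyTransient)) := by
  have hFS : G.FellerSome → G'.FellerSome := by
    rintro ⟨x, t, ht, h⟩
    obtain ⟨x, rfl⟩ := hπ.surjective x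
    exact ⟨x, t, ht, hπ.tendsto_heatKernel ht h⟩
  have hFA : G.FellerAll → G'.FellerAll := fun h x t ht => hπ.tendsto_heatKernel ht (h _ t ht)
  have hU : G.UniformlyTransient → G'.UniformlyTransient := fun ⟨C, hC, h⟩ =>
    ⟨C, hC, fun x => (hπ.green_le x).trans (h _)⟩
  refine ⟨⟨⟨?_, ?_⟩, ⟨?_, ?_⟩⟩, ⟨hFS, hFA⟩, hU, fun hfin => ⟨⟨⟨hFS, ?_⟩, ⟨hFA, ?_⟩⟩, ⟨hU, ?_⟩⟩⟩
  · rintro ⟨x, t, ht, h⟩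
    exact ⟨π x, t, ht, by rwa [← hπ.totalHeat_eq ht]⟩
  · rintro ⟨x, t, ht, h⟩
    obtain ⟨x, rfl⟩ := hπ.surjective x
    exact ⟨x, t, ht, by rwa [hπ.totalHeat_eq ht]⟩
  · intro h x t ht
    obtain ⟨x, rfl⟩ := hπ.surjective x
    rw [← hπ.totalHeat_eq ht]
    exact h x t ht
  · intro h x t ht
    rw [hπ.totalHeat_eq ht]
    exact h _ t ht
  · rintro ⟨x, t, ht, h⟩
    exact ⟨π x, t, ht, hπ.tendsto_heatKernel_of_finite hfin ht h⟩
  · intro h x t ht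
    obtain ⟨x, rfl⟩ := hπ.surjective x
    exact hπ.tendsto_heatKernel_of_finite hfin ht (h x t ht)
  · rintro ⟨C, hC, h⟩
    obtain ⟨n, hn0, hn⟩ := hπ.exists_card_fiber_le hfin
    refine ⟨n * C, by positivity, fun x => ?_⟩
    obtain ⟨x, rfl⟩ := hπ.surjective x
    refine (hπ.green_le_mul hfin hn x).trans ?_
    rw [ENNReal.ofReal_mul (by positivity), ENNReal.ofReal_natCast]
    gcongr
    exact h x
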